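/- Let $(X_1,Y_1),(X_2,Y_2),\ldots$ be independent, identically distributed pairs with values in $\mathbb{R}^n\times\mathbb{R}$ such that $Y_i = X_i^T\beta^* + \epsilon_i$ for some fixed $\beta^*\in\mathbb{R}^n$, where the $\epsilon_i$ are independent, identically distributed, have mean zero and variance $\sigma^2\in(0,\infty)$, and the sequence $(\epsilon_i)$ is independent of the sequence $(X_i)$. Assume that $\mathbb{E}\|X_1\|_2^2<\infty$ and that $\mathbb{P}(|X_1^Tv|=0)<1$ for every unit vector $v\in\mathbb{R}^n$. Let $\mathcal{F}_k=\sigma(X_1,\ldots,X_k)$. For an integer $\tau\ge 1$ put $\phi_\tau(x)=\tau\mathbf{1}\{x>\tau\}+\tau^{-1}\mathbf{1}\{x<\tau^{-1}\}+x\,\mathbf{1}\{\tau^{-1}\le x\le\tau\}$. Let $\beta_0\in\mathbb{R}^n$ be arbitrary and let $M_0$ be any (deterministic) symmetric positive definite $n\times n$ matrix. For hyperparameters (forgetting factors) $f_k$, define recursively for $k\ge1$ the residual $r_k=Y_k-X_k^T\beta_{k-1}$, the estimator $$\xi_1^2=r_1^2,\qquad \xi_k^2=\frac1k f_k r_k^2+\Bigl(1-\frac1k\Bigr)\xi_{k-1}^2\quad(k\ge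 2),$$ the tuning parameter $\gamma_k^2=\phi_\tau(\xi_k^2)$, and the updates $$\beta_k=\beta_{k-1}+\frac{M_{k-1}X_k}{\gamma_k^2+X_k^TM_{k-1}X_k}\,(Y_k-\beta_{k-1}^TX_k),\qquad M_k=\Bigl(I-\frac{M_{k-1}X_kX_k^T}{\gamma_k^2+X_k^TM_{k-1}X_k}\Bigr)M_{k-1}.$$ If $f_k=1$ for all $k$, then every $\xi_k^2$ and every $\gamma_k^2$ is integrable, and $$\lim_{k\to\infty}\mathbb{E}[\xi_k^2\mid\mathcal{F}_k]=\sigma^2\quad\text{almost surely.}$$ Moreover, almost surely, $$\phi_\tau(\sigma^2)\le\liminf_{k\to\infty}\mathbb{E}[\gamma_k^2\mid\mathcal{F}_k]\le\limsup_{k\to\infty}\mathbb{E}[\gamma_k^2\mid\mathcal{F}_k]\le\phi_\tau(\sigma^2+\tau^{-1}).$$ -/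

import Mathlib

open MeasureTheory ProbabilityTheory Filter Topology

namespace KSGD

/-- The truncation `φ_τ(x) = τ 1{x > τ} + τ⁻¹ 1{x < τ⁻¹} + x 1{τ⁻¹ ≤ x ≤ τ}`. -/
noncomputable def phi (τ : ℕ) (x : ℝ) : ℝ :=
  (if x > (τ : ℝ) then (τ : ℝ) else 0) + (if x < (τ : ℝ)⁻¹ then (τ : ℝ)⁻¹ else 0) +
    (if (τ : ℝ)⁻¹ ≤ x ∧ x ≤ (τ : ℝ) then x else 0)

/-- What the method stores after `k` observations: the parameter estimate `β_k`, the estimated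
covariance `M_k`, and the running estimator `ξ_k²` of the noise variance. -/
structure State (n : ℕ) where
  beta : EuclideanSpace ℝ (Fin n)
  M : Matrix (Fin n) (Fin n) ℝ
  xiSq : ℝ

/-- The residual `r = y - xᵀ β` of a new observation `(x, y)`. -/
noncomputable def resid {n : ℕ} (s : State n) (x : EuclideanSpace ℝ (Fin n)) (y : ℝ) : ℝ :=
  y - x.ofLp ⬝ᵥ s.beta.ofLp

/-- `ξ_1² = r_1²` and `ξ_{k+1}² = f_{k+1} r_{k+1}² / (k+1) + (1 - 1/(k+1)) ξ_k²`,
where `s` is the state after `k` observations and `f` stands for `f_{k+1}`. -/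
noncomputable def nextXiSq {n : ℕ} (k : ℕ) (f : ℝ) (s : State n)
    (x : EuclideanSpace ℝ (Fin n)) (y : ℝ) : ℝ :=
  if k = 0 then resid s x y ^ 2
  else 1 / ((k : ℝ) + 1) * f * resid s x y ^ 2 + (1 - 1 / ((k : ℝ) + 1)) * s.xiSq

/-- The parameter update
`β_{k+1} = β_k + M_k x (y - β_kᵀ x) / (γ² + xᵀ M_k x)`, with `g` standing for `γ²`. -/
noncomputable def nextBeta {n : ℕ} (g : ℝ) (s : State n)
    (x : EuclideanSpace ℝ (Fin n)) (y : ℝ) : EuclideanSpace ℝ (Fin n) :=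
  s.beta + (resid s x y / (g + x.ofLp ⬝ᵥ (s.M.mulVec x.ofLp))) •
    WithLp.toLp 2 (s.M.mulVec x.ofLp)

/-- The covariance update
`M_{k+1} = (I - M_k x xᵀ / (γ² + xᵀ M_k x)) M_k`, with `g` standing for `γ²`. -/
noncomputable def nextM {n : ℕ} (g : ℝ) (s : State n) (x : EuclideanSpace ℝ (Fin n)) :
    Matrix (Fin n) (Fin n) ℝ :=
  (1 - (g + x.ofLp ⬝ᵥ (s.M.mulVec x.ofLp))⁻¹ • (s.M * Matrix.vecMulVec x.ofLp x.ofLp)) * s.M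

/-- The kSGD iteration with adaptive tuning parameters `γ_k² = φ_τ(ξ_k²)`, run on the data
`(x 0, y 0), (x 1, y 1), …` with hyperparameters `f 0, f 1, …`. The observation with number
`k + 1` is `(x k, y k)`, its hyperparameter is `f k`, and `run … k` is the state after the first
`k` observations. The stored value of `ξ²` before the first observation is never used. -/
noncomputable def run {n : ℕ} (τ : ℕ) (β₀ : EuclideanSpace ℝ (Fin n))
    (M₀ : Matrix (Fin n) (Fin n) ℝ) (f : ℕ → ℝ)
    (x : ℕ → EuclideanSpace ℝ (Fin n)) (y : ℕ → ℝ) : ℕ → State n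
  | 0 => ⟨β₀, M₀, 0⟩
  | k + 1 =>
    let s := run τ β₀ M₀ f x y k
    let z := nextXiSq k (f k) s (x k) (y k)
    ⟨nextBeta (phi τ z) s (x k) (y k), nextM (phi τ z) s (x k), z⟩

/-- The random variable `ξ_k²` obtained from the random data `(X i, Y i)`. -/
noncomputable def xiSq {Ω : Type*} {n : ℕ} (τ : ℕ) (β₀ : EuclideanSpace ℝ (Fin n))
    (M₀ : Matrix (Fin n) (Fin n) ℝ) (f : ℕ → ℝ)
    (X : ℕ → Ω → EuclideanSpace ℝ (Fin n)) (Y : ℕ → Ω → ℝ) (k : ℕ) (ω : Ω) : ℝ :=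
  (run τ β₀ M₀ f (fun i => X i ω) (fun i => Y i ω) k).xiSq

/-- The random tuning parameter `γ_k² = φ_τ(ξ_k²)`; for `k ≥ 1` it is the one used in the `k`-th
step of `run`. -/
noncomputable def gammaSq {Ω : Type*} {n : ℕ} (τ : ℕ) (β₀ : EuclideanSpace ℝ (Fin n))
    (M₀ : Matrix (Fin n) (Fin n) ℝ) (f : ℕ → ℝ)
    (X : ℕ → Ω → EuclideanSpace ℝ (Fin n)) (Y : ℕ → Ω → ℝ) (k : ℕ) (ω : Ω) : ℝ :=
  phi τ (xiSq τ β₀ M₀ f X Y k ω)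

/-- `𝓕_k`, the σ-algebra generated by the first `k` covariates `X 0, …, X (k - 1)`. -/
@[reducible] def sigmaX {Ω : Type*} {n : ℕ} (X : ℕ → Ω → EuclideanSpace ℝ (Fin n)) (k : ℕ) :
    MeasurableSpace Ω :=
  ⨆ (i : ℕ) (_ : i < k), MeasurableSpace.comap (X i) inferInstance

/-- The linear model: the pairs `(X i, Y i)` are i.i.d., `Y i = (X i)ᵀ β* + ε i`, and the noise
variables `ε i` are i.i.d., centred, of variance `σ² ∈ (0, ∞)`, and independent of all the `X i`. -/
structure LinearModel {Ω : Type*} [MeasurableSpace Ω] (P : Measure Ω) {n : ℕ}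
    (X : ℕ → Ω → EuclideanSpace ℝ (Fin n)) (Y ε : ℕ → Ω → ℝ)
    (βstar : EuclideanSpace ℝ (Fin n)) (σ : ℝ) : Prop where
  measurable_X : ∀ i, Measurable (X i)
  measurable_Y : ∀ i, Measurable (Y i)
  measurable_noise : ∀ i, Measurable (ε i)
  indep_data : iIndepFun (fun i ω => (X i ω, Y i ω)) P
  identDistrib_data :
    ∀ i, IdentDistrib (fun ω => (X i ω, Y i ω)) (fun ω => (X 0 ω, Y 0 ω)) P P
  model : ∀ i, ∀ᵐ ω ∂P, Y i ω = (X i ω).ofLp ⬝ᵥ βstar.ofLp + ε i ω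
  indep_noise : iIndepFun ε P
  identDistrib_noise : ∀ i, IdentDistrib (ε i) (ε 0) P P
  memLp_noise : ∀ i, MemLp (ε i) 2 P
  mean_noise : ∀ i, ∫ ω, ε i ω ∂P = 0
  sigma_pos : 0 < σ
  variance_noise : ∀ i, variance (ε i) P = σ ^ 2
  noise_indep_X : IndepFun (fun ω i => ε i ω) (fun ω i => X i ω) P

end KSGD

namespace KSGD

open scoped RealInnerProductSpace

/-! The iteration is recursive least squares with weights `w_i = 1/γ²` confined to `[1/τ, τ]`.
Inverting the covariance update gives the normal equations `A_k (β_k - β*) = M₀⁻¹ (β₀ - β*) + ∑ w_i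
ε_i x_i` with `A_k = M₀⁻¹ + ∑ w_i x_i x_iᵀ` (`gramOp_err`). Since the noise is independent of the
covariates, conditioning on `𝓕_k` freezes the design and integrates over the noise
(`LinearModel.condExp_sigmaX`). By the strong law almost every design has convergent averages of
`‖x_i‖²` and a Gram matrix bounded below by a multiple of `k`, so everything reduces to such a fixed
design.

The obstacle is that `w_i` depends on `ε_i`, so the noise sum is not a martingale. Replacing `w_i`
by a predictable weight makes it one; the error committed is controlled by `min(τ, r²/(i+1))`, where
`r` is the new residual. The argument then runs twice. Cauchy–Schwarz alone bounds the mean squared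
error of `β_k` (`exists_eventually_integral_sq_norm_err_le`). This bound makes the weight correction
vanish in mean square, and the martingale estimate then gives consistency
(`tendsto_integral_sq_norm_err`).

Each prediction error is independent of the new noise, so the mean of `ξ_k²` is `σ²` plus the
average mean squared prediction error, which tends to zero. For `γ_k²`, the distance in `L¹` from
`ξ_k²` to the average of the `ε_i²` tends to zero and `φ_τ` is bounded and 1-Lipschitz, so the
conditional mean converges to `φ_τ(σ²)` itself. The stated upper bound follows by monotonicity. -/

/-! ### The truncation as a clamp -/

theorem phi_eq_clamp {τ : ℕ} (hτ : 1 ≤ τ) (x : ℝ) :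
    phi τ x = max (τ : ℝ)⁻¹ (min (τ : ℝ) x) := by
  have h1 : (1 : ℝ) ≤ τ := by exact_mod_cast hτ
  have h2 : (τ : ℝ)⁻¹ ≤ 1 := inv_le_one_of_one_le₀ h1
  unfold phi
  rcases lt_or_ge x (τ : ℝ)⁻¹ with h | h
  · have : ¬ x > (τ : ℝ) := by linarith
    have h' : ¬ ((τ : ℝ)⁻¹ ≤ x) := not_le.2 h
    rw [if_neg this, if_pos h, if_neg (fun h'' => h' h''.1), min_eq_right (by linarith),
      max_eq_left h.le]
    ring
  · rcases lt_or_ge (τ : ℝ) x with h3 | h3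
    · rw [if_pos h3, if_neg (not_lt.2 h), if_neg (fun h'' => absurd h''.2 (not_le.2 h3)),
        min_eq_left h3.le, max_eq_right (by linarith)]
      ring
    · rw [if_neg (not_lt.2 h3), if_neg (not_lt.2 h), if_pos ⟨h, h3⟩, min_eq_right h3,
        max_eq_right h]
      ring

theorem inv_le_phi {τ : ℕ} (hτ : 1 ≤ τ) (x : ℝ) : (τ : ℝ)⁻¹ ≤ phi τ x := by
  rw [phi_eq_clamp hτ]; exact le_max_left _ _

theorem phi_le {τ : ℕ} (hτ : 1 ≤ τ) (x : ℝ) : phi τ x ≤ τ := by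
  have h1 : (1 : ℝ) ≤ τ := by exact_mod_cast hτ
  rw [phi_eq_clamp hτ]
  exact max_le ((inv_le_one_of_one_le₀ h1).trans h1) (min_le_left _ _)

theorem phi_pos {τ : ℕ} (hτ : 1 ≤ τ) (x : ℝ) : 0 < phi τ x :=
  lt_of_lt_of_le (by have : 0 < τ := hτ
                     positivity) (inv_le_phi hτ x)

theorem inv_phi_le {τ : ℕ} (hτ : 1 ≤ τ) (x : ℝ) : (phi τ x)⁻¹ ≤ τ :=
  inv_le_of_inv_le₀ (by exact_mod_cast hτ) (inv_le_phi hτ x)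

theorem inv_le_inv_phi {τ : ℕ} (hτ : 1 ≤ τ) (x : ℝ) : (τ : ℝ)⁻¹ ≤ (phi τ x)⁻¹ :=
  inv_anti₀ (phi_pos hτ x) (phi_le hτ x)

theorem phi_mono {τ : ℕ} (hτ : 1 ≤ τ) : Monotone (phi τ) := by
  intro x y h
  rw [phi_eq_clamp hτ, phi_eq_clamp hτ]
  exact max_le_max le_rfl (min_le_min le_rfl h)

theorem continuous_phi {τ : ℕ} (hτ : 1 ≤ τ) : Continuous (phi τ) := by
  have : phi τ = fun x => max (τ : ℝ)⁻¹ (min (τ : ℝ) x) := funext (phi_eq_clamp hτ)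
  rw [this]; fun_prop

theorem abs_phi_sub_phi_le {τ : ℕ} (hτ : 1 ≤ τ) (x y : ℝ) :
    |phi τ x - phi τ y| ≤ |x - y| := by
  rw [phi_eq_clamp hτ, phi_eq_clamp hτ]
  refine (abs_max_sub_max_le_max _ _ _ _).trans ?_
  have := abs_min_sub_min_le_max (τ : ℝ) x τ y
  simpa using this

/-! ### Recursive least squares and the normal equations -/

/-- The effect on the inverse covariance of one recursive least squares step. -/
theorem rls_step {E : Type*} [NormedAddCommGroup E] [InnerProductSpace ℝ E]
    (A : E →L[ℝ] E) (x m : E) (g : ℝ) (hg : 0 < g) (hA : 0 ≤ ⟪m, A m⟫) (hm : A m = x)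
    (c : ℝ) (v w : E) (hv : A v = w) :
    (A + g⁻¹ • InnerProductSpace.rankOne ℝ x x) (v + ((c - ⟪x, v⟫) / (g + ⟪x, m⟫)) • m)
      = w + (g⁻¹ * c) • x := by
  have hD : g + ⟪x, m⟫ ≠ 0 := by
    rw [hm, real_inner_comm] at hA
    positivity
  -- The total coefficient of `x` on the left once `A v = w` and `A m = x` are used; this is the
  -- Sherman–Morrison cancellation.
  have hc : g⁻¹ * ⟪x, v⟫ + (c - ⟪x, v⟫) / (g + ⟪x, m⟫)
      + (c - ⟪x, v⟫) / (g + ⟪x, m⟫) * (g⁻¹ * ⟪x, m⟫) = g⁻¹ * c := by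
    field_simp
    ring
  simp only [add_apply, smul_apply, map_add, map_smul,
    InnerProductSpace.rankOne_apply, hv, hm]
  rw [← hc]
  module

/-- `T + ∑ i < k, w i • x i (x i)ᵀ` as an operator. -/
noncomputable def gramOp {E : Type*} [NormedAddCommGroup E] [InnerProductSpace ℝ E]
    (T : E →L[ℝ] E) (w : ℕ → ℝ) (x : ℕ → E) (k : ℕ) : E →L[ℝ] E :=
  T + ∑ i ∈ Finset.range k, w i • InnerProductSpace.rankOne ℝ (x i) (x i)

theorem gramOp_succ {E : Type*} [NormedAddCommGroup E] [InnerProductSpace ℝ E]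
    (T : E →L[ℝ] E) (w : ℕ → ℝ) (x : ℕ → E) (k : ℕ) :
    gramOp T w x (k + 1) = gramOp T w x k + w k • InnerProductSpace.rankOne ℝ (x k) (x k) := by
  simp [gramOp, Finset.sum_range_succ, add_assoc]

theorem inner_gramOp {E : Type*} [NormedAddCommGroup E] [InnerProductSpace ℝ E]
    (T : E →L[ℝ] E) (w : ℕ → ℝ) (x : ℕ → E) (k : ℕ) (v : E) :
    ⟪v, gramOp T w x k v⟫ = ⟪v, T v⟫ + ∑ i ∈ Finset.range k, w i * ⟪x i, v⟫ ^ 2 := by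
  simp only [gramOp, add_apply, sum_apply, smul_apply, inner_add_right,
    inner_sum, inner_smul_right, InnerProductSpace.rankOne_apply, real_inner_comm v, sq]

section Trajectory

variable {n : ℕ} (τ : ℕ) (β₀ : EuclideanSpace ℝ (Fin n)) (M₀ : Matrix (Fin n) (Fin n) ℝ)
  (βs : EuclideanSpace ℝ (Fin n)) (x : ℕ → EuclideanSpace ℝ (Fin n)) (e : ℕ → ℝ)

/-- The run with all forgetting factors `1` on the responses `(x i)ᵀ βs + e i`. -/
noncomputable def traj (k : ℕ) : State n :=
  run τ β₀ M₀ (fun _ => 1) x (fun i => (x i).ofLp ⬝ᵥ βs.ofLp + e i) k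

/-- The estimation error `β_k - βs`. -/
noncomputable def err (k : ℕ) : EuclideanSpace ℝ (Fin n) := (traj τ β₀ M₀ βs x e k).beta - βs

/-- The prediction error `(x k)ᵀ (β_k - βs)` on the next covariate. -/
noncomputable def predErr (k : ℕ) : ℝ := ⟪x k, err τ β₀ M₀ βs x e k⟫

/-- The reciprocal of the tuning parameter used in step `k + 1`. -/
noncomputable def weight (k : ℕ) : ℝ := (phi τ (traj τ β₀ M₀ βs x e (k + 1)).xiSq)⁻¹

/-- The covariance matrix after `k` steps, as an operator. -/
noncomputable def covOp (k : ℕ) : EuclideanSpace ℝ (Fin n) →L[ℝ] EuclideanSpace ℝ (Fin n) :=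
  Matrix.toEuclideanCLM (n := Fin n) (𝕜 := ℝ) (traj τ β₀ M₀ βs x e k).M

theorem dotProduct_eq_inner (a b : EuclideanSpace ℝ (Fin n)) : a.ofLp ⬝ᵥ b.ofLp = ⟪a, b⟫ := by
  rw [EuclideanSpace.inner_eq_star_dotProduct, dotProduct_comm]
  simp

theorem resid_traj (k : ℕ) :
    resid (traj τ β₀ M₀ βs x e k) (x k) ((x k).ofLp ⬝ᵥ βs.ofLp + e k)
      = e k - predErr τ β₀ M₀ βs x e k := by
  simp only [resid, dotProduct_eq_inner, predErr, err, inner_sub_right]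
  ring

theorem traj_xiSq_succ (k : ℕ) :
    (traj τ β₀ M₀ βs x e (k + 1)).xiSq
      = 1 / ((k : ℝ) + 1) * (e k - predErr τ β₀ M₀ βs x e k) ^ 2
        + (1 - 1 / ((k : ℝ) + 1)) * (traj τ β₀ M₀ βs x e k).xiSq := by
  rw [← resid_traj]
  change nextXiSq k 1 (traj τ β₀ M₀ βs x e k) (x k) _ = _
  unfold nextXiSq
  -- At `k = 0` the factor `1 - 1/(k+1)` vanishes, so the first step obeys the general formula.
  split_ifs with h
  · subst h; simp
  · ring

/-- With all factors equal to one, the recursion is that of a running mean. At `k = 0` the quotient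
is `0 / 0 = 0`, the stored initial value. -/
theorem traj_xiSq (k : ℕ) :
    (traj τ β₀ M₀ βs x e k).xiSq
      = (∑ i ∈ Finset.range k, (e i - predErr τ β₀ M₀ βs x e i) ^ 2) / k := by
  induction k with
  | zero => simp [traj, run]
  | succ k ih =>
    rw [traj_xiSq_succ, ih, Finset.sum_range_succ]
    push_cast
    rcases eq_or_ne k 0 with rfl | hk
    · simp
    · field_simp
      ring

theorem inner_covOp (k : ℕ) :
    (x k).ofLp ⬝ᵥ ((traj τ β₀ M₀ βs x e k).M.mulVec (x k).ofLp)
      = ⟪x k, covOp τ β₀ M₀ βs x e k (x k)⟫ := by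
  rw [covOp, Matrix.inner_toEuclideanCLM]

theorem err_succ (k : ℕ) :
    err τ β₀ M₀ βs x e (k + 1) = err τ β₀ M₀ βs x e k
      + ((e k - predErr τ β₀ M₀ βs x e k) /
          ((weight τ β₀ M₀ βs x e k)⁻¹ + ⟪x k, covOp τ β₀ M₀ βs x e k (x k)⟫)) •
        covOp τ β₀ M₀ βs x e k (x k) := by
  rw [← inner_covOp, ← resid_traj, weight, inv_inv]
  change nextBeta _ (traj τ β₀ M₀ βs x e k) (x k) _ - βs = _
  rw [nextBeta, err]
  change _ + _ • covOp τ β₀ M₀ βs x e k (x k) - βs = _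
  rw [add_sub_right_comm]
  rfl

/-- The difference `0 - ⟪x, M v⟫` puts the covariance update in the shape of the error update with
target zero, so that `rls_step` serves both. -/
theorem covOp_succ (k : ℕ) (v : EuclideanSpace ℝ (Fin n)) :
    covOp τ β₀ M₀ βs x e (k + 1) v = covOp τ β₀ M₀ βs x e k v
      + ((0 - ⟪x k, covOp τ β₀ M₀ βs x e k v⟫) /
          ((weight τ β₀ M₀ βs x e k)⁻¹ + ⟪x k, covOp τ β₀ M₀ βs x e k (x k)⟫)) •
        covOp τ β₀ M₀ βs x e k (x k) := by
  rw [← inner_covOp, weight, inv_inv]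
  change Matrix.toEuclideanCLM (n := Fin n) (𝕜 := ℝ)
    (nextM (phi τ (traj τ β₀ M₀ βs x e (k + 1)).xiSq) (traj τ β₀ M₀ βs x e k) (x k)) v = _
  have hx : Matrix.toEuclideanCLM (n := Fin n) (𝕜 := ℝ)
      (Matrix.vecMulVec (x k).ofLp (x k).ofLp) = InnerProductSpace.rankOne ℝ (x k) (x k) := by
    ext w i
    simp [Matrix.vecMulVec_mulVec, ← dotProduct_eq_inner, mul_comm]
  rw [nextM, map_mul, map_sub, map_smul, map_mul, map_one, hx, covOp]
  simp only [mul_apply_eq_comp, sub_apply, smul_apply, one_apply_eq_self,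
    InnerProductSpace.rankOne_apply, map_smul, smul_smul]
  rw [sub_eq_add_neg, ← neg_smul]
  congr 2
  ring

variable {τ M₀}

theorem weight_nonneg (hτ : 1 ≤ τ) (k : ℕ) : 0 ≤ weight τ β₀ M₀ βs x e k :=
  (inv_pos.2 (phi_pos hτ _)).le

theorem weight_le (hτ : 1 ≤ τ) (k : ℕ) : weight τ β₀ M₀ βs x e k ≤ τ := inv_phi_le hτ _

theorem le_weight (hτ : 1 ≤ τ) (k : ℕ) : (τ : ℝ)⁻¹ ≤ weight τ β₀ M₀ βs x e k :=
  inv_le_inv_phi hτ _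

/-- The inverse of the initial covariance matrix, as an operator. -/
noncomputable def precOp (M₀ : Matrix (Fin n) (Fin n) ℝ) :
    EuclideanSpace ℝ (Fin n) →L[ℝ] EuclideanSpace ℝ (Fin n) :=
  Matrix.toEuclideanCLM (n := Fin n) (𝕜 := ℝ) M₀⁻¹

theorem inner_precOp_pos (hM₀ : M₀.PosDef) {v : EuclideanSpace ℝ (Fin n)} (hv : v ≠ 0) :
    0 < ⟪v, precOp M₀ v⟫ := by
  rw [precOp, Matrix.inner_toEuclideanCLM]
  have := hM₀.inv.dotProduct_mulVec_pos (x := v.ofLp) (by simpa using hv)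
  simpa using this

theorem inner_precOp_nonneg (hM₀ : M₀.PosDef) (v : EuclideanSpace ℝ (Fin n)) :
    0 ≤ ⟪v, precOp M₀ v⟫ := by
  rcases eq_or_ne v 0 with rfl | hv
  · simp
  · exact (inner_precOp_pos hM₀ hv).le

theorem inner_gramOp_precOp_nonneg (hτ : 1 ≤ τ) (hM₀ : M₀.PosDef) (k : ℕ)
    (v : EuclideanSpace ℝ (Fin n)) :
    0 ≤ ⟪v, gramOp (precOp M₀) (weight τ β₀ M₀ βs x e) x k v⟫ := by
  rw [inner_gramOp]
  exact add_nonneg (inner_precOp_nonneg hM₀ v)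
    (Finset.sum_nonneg fun i _ => mul_nonneg (weight_nonneg _ _ _ _ hτ i) (sq_nonneg _))

/-- Sherman–Morrison, step by step. Its role is to identify the gain direction `M_k x_k` as a
preimage of `x_k` under the precision operator in `gramOp_err`. -/
theorem gramOp_covOp (hτ : 1 ≤ τ) (hM₀ : M₀.PosDef) (k : ℕ) (v : EuclideanSpace ℝ (Fin n)) :
    gramOp (precOp M₀) (weight τ β₀ M₀ βs x e) x k (covOp τ β₀ M₀ βs x e k v) = v := by
  induction k generalizing v with
  | zero =>
    have h : precOp M₀ * covOp τ β₀ M₀ βs x e 0 = 1 := by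
      rw [precOp, covOp, ← map_mul]
      change Matrix.toEuclideanCLM (n := Fin n) (𝕜 := ℝ) (M₀⁻¹ * M₀) = 1
      rw [Matrix.nonsing_inv_mul _ ((Matrix.isUnit_iff_isUnit_det _).1 hM₀.isUnit), map_one]
    simpa [gramOp] using congrArg (fun T => T v) h
  | succ k ih =>
    have hw : 0 < (weight τ β₀ M₀ βs x e k)⁻¹ := by rw [weight, inv_inv]; exact phi_pos hτ _
    have := rls_step (gramOp (precOp M₀) (weight τ β₀ M₀ βs x e) x k) (x k)
      (covOp τ β₀ M₀ βs x e k (x k)) (weight τ β₀ M₀ βs x e k)⁻¹ hw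
      (inner_gramOp_precOp_nonneg _ _ _ _ hτ hM₀ k _) (ih (x k)) 0 _ _ (ih v)
    rw [covOp_succ, gramOp_succ]
    simpa using this

/-- In the precision coordinates each update merely adds `w_k e_k x_k`: the gain and the
denominators disappear. -/
theorem gramOp_err (hτ : 1 ≤ τ) (hM₀ : M₀.PosDef) (k : ℕ) :
    gramOp (precOp M₀) (weight τ β₀ M₀ βs x e) x k (err τ β₀ M₀ βs x e k)
      = precOp M₀ (β₀ - βs)
        + ∑ i ∈ Finset.range k, (weight τ β₀ M₀ βs x e i * e i) • x i := by
  induction k with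
  | zero => simp [gramOp, err, traj, run]
  | succ k ih =>
    have hw : 0 < (weight τ β₀ M₀ βs x e k)⁻¹ := by rw [weight, inv_inv]; exact phi_pos hτ _
    have := rls_step (gramOp (precOp M₀) (weight τ β₀ M₀ βs x e) x k) (x k)
      (covOp τ β₀ M₀ βs x e k (x k)) (weight τ β₀ M₀ βs x e k)⁻¹ hw
      (inner_gramOp_precOp_nonneg _ _ _ _ hτ hM₀ k _) (gramOp_covOp _ _ _ _ hτ hM₀ k (x k))
      (e k) _ _ ih
    rw [err_succ, gramOp_succ, Finset.sum_range_succ, ← add_assoc]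
    simpa [predErr] using this

end Trajectory

/-! ### Pathwise bounds on the estimation error -/

theorem exists_pos_mul_sq_norm_le_inner {E : Type*} [NormedAddCommGroup E]
    [InnerProductSpace ℝ E] [FiniteDimensional ℝ E] (T : E →L[ℝ] E)
    (hT : ∀ v, ‖v‖ = 1 → 0 < ⟪v, T v⟫) : ∃ c > 0, ∀ v, c * ‖v‖ ^ 2 ≤ ⟪v, T v⟫ := by
  have key : ∃ c > 0, ∀ v : E, ‖v‖ = 1 → c ≤ ⟪v, T v⟫ := by
    -- In dimension zero the sphere is empty and any constant works.
    rcases (Metric.sphere (0 : E) 1).eq_empty_or_nonempty with h | h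
    · refine ⟨1, one_pos, fun v hv => ?_⟩
      have : v ∈ Metric.sphere (0 : E) 1 := by simpa using hv
      rw [h] at this
      exact this.elim
    · obtain ⟨u, hu, hmin⟩ := (isCompact_sphere (0 : E) 1).exists_isMinOn h
        (f := fun v => ⟪v, T v⟫) (by fun_prop)
      exact ⟨⟪u, T u⟫, hT u (by simpa using hu), fun v hv => hmin (by simpa using hv)⟩
  obtain ⟨c, hc, h⟩ := key
  refine ⟨c, hc, fun v => ?_⟩
  rcases eq_or_ne v 0 with rfl | hv
  · simp
  have hv' : ‖v‖ ≠ 0 := norm_ne_zero_iff.2 hv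
  have := h (‖v‖⁻¹ • v) (by rw [norm_smul, norm_inv, norm_norm, inv_mul_cancel₀ hv'])
  rw [map_smul, inner_smul_left, inner_smul_right] at this
  simp only [conj_trivial] at this
  calc c * ‖v‖ ^ 2 ≤ (‖v‖⁻¹ * (‖v‖⁻¹ * ⟪v, T v⟫)) * ‖v‖ ^ 2 := by gcongr
    _ = _ := by field_simp

theorem mul_norm_le_of_coercive {E : Type*} [NormedAddCommGroup E]
    [InnerProductSpace ℝ E] (T : E →L[ℝ] E) {c : ℝ} {v : E}
    (h : c * ‖v‖ ^ 2 ≤ ⟪v, T v⟫) : c * ‖v‖ ≤ ‖T v‖ := by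
  rcases eq_or_ne v 0 with rfl | hv
  · simp
  have hv' : 0 < ‖v‖ := norm_pos_iff.2 hv
  refine le_of_mul_le_mul_right ?_ hv'
  calc c * ‖v‖ * ‖v‖ = c * ‖v‖ ^ 2 := by ring
    _ ≤ ‖v‖ * ‖T v‖ := h.trans (real_inner_le_norm _ _)
    _ = _ := mul_comm _ _

section Trajectory

variable {n : ℕ} {τ : ℕ} (β₀ : EuclideanSpace ℝ (Fin n)) {M₀ : Matrix (Fin n) (Fin n) ℝ}
  (βs : EuclideanSpace ℝ (Fin n)) (x : ℕ → EuclideanSpace ℝ (Fin n)) (e : ℕ → ℝ)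

/-- The right-hand side of the normal equations solved by the estimation error. -/
noncomputable def score (τ : ℕ) (M₀ : Matrix (Fin n) (Fin n) ℝ) (k : ℕ) :
    EuclideanSpace ℝ (Fin n) :=
  precOp M₀ (β₀ - βs) + ∑ i ∈ Finset.range k, (weight τ β₀ M₀ βs x e i * e i) • x i

/-- Only the initial precision is used, as the later terms are nonnegative. The constant is
therefore uniform in design, noise and time, which is what integrability needs. -/
theorem exists_pos_mul_norm_err_le (hτ : 1 ≤ τ) (hM₀ : M₀.PosDef) :
    ∃ c > 0, ∀ x e k, c * ‖err τ β₀ M₀ βs x e k‖ ≤ ‖score β₀ βs x e τ M₀ k‖ := by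
  obtain ⟨c, hc, h⟩ := exists_pos_mul_sq_norm_le_inner (precOp M₀) fun v hv =>
    inner_precOp_pos hM₀ (norm_ne_zero_iff.1 (by rw [hv]; exact one_ne_zero))
  refine ⟨c, hc, fun x e k => ?_⟩
  rw [score, ← gramOp_err _ _ _ _ hτ hM₀]
  refine mul_norm_le_of_coercive _ ((h _).trans ?_)
  rw [inner_gramOp]
  exact le_add_of_nonneg_right
    (Finset.sum_nonneg fun i _ => mul_nonneg (weight_nonneg _ _ _ _ hτ i) (sq_nonneg _))

theorem mul_norm_err_le_of_le_sum (hτ : 1 ≤ τ) (hM₀ : M₀.PosDef) {c : ℝ} {k : ℕ}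
    (h : ∀ v, c * ‖v‖ ^ 2 ≤ ∑ i ∈ Finset.range k, ⟪x i, v⟫ ^ 2) :
    (τ : ℝ)⁻¹ * c * ‖err τ β₀ M₀ βs x e k‖ ≤ ‖score β₀ βs x e τ M₀ k‖ := by
  rw [score, ← gramOp_err _ _ _ _ hτ hM₀]
  refine mul_norm_le_of_coercive _ ?_
  rw [inner_gramOp, mul_assoc]
  refine (mul_le_mul_of_nonneg_left (h _) (by positivity)).trans ?_
  rw [Finset.mul_sum]
  refine le_add_of_nonneg_of_le (inner_precOp_nonneg hM₀ _) (Finset.sum_le_sum fun i _ => ?_)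
  gcongr
  exact le_weight _ _ _ _ hτ i

/-- Cauchy–Schwarz, with no use of cancellation in the noise: typically of order `k²`, enough for
boundedness of the error but not for consistency. -/
theorem sq_norm_score_le (hτ : 1 ≤ τ) (k : ℕ) :
    ‖score β₀ βs x e τ M₀ k‖ ^ 2 ≤ 2 * ‖precOp M₀ (β₀ - βs)‖ ^ 2
      + 2 * τ ^ 2 * (∑ i ∈ Finset.range k, ‖x i‖ ^ 2) * ∑ i ∈ Finset.range k, e i ^ 2 := by
  have h1 : ‖∑ i ∈ Finset.range k, (weight τ β₀ M₀ βs x e i * e i) • x i‖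
      ≤ τ * ∑ i ∈ Finset.range k, ‖x i‖ * |e i| := by
    rw [Finset.mul_sum]
    refine (norm_sum_le _ _).trans (Finset.sum_le_sum fun i _ => ?_)
    rw [norm_smul, norm_mul, Real.norm_eq_abs, Real.norm_eq_abs,
      abs_of_nonneg (weight_nonneg _ _ _ _ hτ i)]
    have := mul_le_mul_of_nonneg_right (weight_le β₀ (M₀ := M₀) βs x e hτ i)
      (by positivity : 0 ≤ |e i| * ‖x i‖)
    linarith
  have h2 := Finset.sum_mul_sq_le_sq_mul_sq (Finset.range k) (fun i => ‖x i‖) (fun i => |e i|)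
  simp only [sq_abs] at h2
  have h3 := norm_add_le (precOp M₀ (β₀ - βs))
    (∑ i ∈ Finset.range k, (weight τ β₀ M₀ βs x e i * e i) • x i)
  set S := ∑ i ∈ Finset.range k, ‖x i‖ * |e i|
  set p := ‖precOp M₀ (β₀ - βs)‖
  calc ‖score β₀ βs x e τ M₀ k‖ ^ 2 ≤ (p + τ * S) ^ 2 := by
        gcongr
        exact h3.trans (by gcongr)
    _ ≤ 2 * p ^ 2 + 2 * τ ^ 2 * S ^ 2 := by nlinarith [sq_nonneg (p - τ * S)]
    _ ≤ _ := by rw [mul_assoc (2 * (τ : ℝ) ^ 2)]; gcongr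

variable (τ M₀)

theorem traj_congr {x x' : ℕ → EuclideanSpace ℝ (Fin n)} {e e' : ℕ → ℝ} {k : ℕ}
    (hx : ∀ i < k, x i = x' i) (he : ∀ i < k, e i = e' i) :
    traj τ β₀ M₀ βs x e k = traj τ β₀ M₀ βs x' e' k := by
  induction k with
  | zero => rfl
  | succ k ih =>
    have := ih (fun i hi => hx i (hi.trans k.lt_succ_self))
      (fun i hi => he i (hi.trans k.lt_succ_self))
    simp only [traj] at this ⊢
    simp only [run, this, hx k k.lt_succ_self, he k k.lt_succ_self]

/-- The strict bound on the noise indices is what makes the prediction error independent of the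
noise in the same step. -/
theorem predErr_congr {x x' : ℕ → EuclideanSpace ℝ (Fin n)} {e e' : ℕ → ℝ} {k : ℕ}
    (hx : ∀ i ≤ k, x i = x' i) (he : ∀ i < k, e i = e' i) :
    predErr τ β₀ M₀ βs x e k = predErr τ β₀ M₀ βs x' e' k := by
  rw [predErr, predErr, err, err, traj_congr τ β₀ M₀ βs (fun i hi => hx i hi.le) he, hx k le_rfl]

section Measurability

variable {α : Type*} [MeasurableSpace α] {ξ : α → ℕ → EuclideanSpace ℝ (Fin n)}
  {η : α → ℕ → ℝ} {τ}

/-- The parameter space is general because it is later a space of noise sequences, the sample space,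
or the product of design and noise sequences. -/
theorem measurable_traj (hτ : 1 ≤ τ) (hξ : ∀ i, Measurable fun a => ξ a i)
    (hη : ∀ i, Measurable fun a => η a i) (k : ℕ) :
    (Measurable fun a => (traj τ β₀ M₀ βs (ξ a) (η a) k).beta) ∧
    (∀ i j, Measurable fun a => (traj τ β₀ M₀ βs (ξ a) (η a) k).M i j) ∧
    Measurable fun a => (traj τ β₀ M₀ βs (ξ a) (η a) k).xiSq := by
  induction k with
  | zero => exact ⟨measurable_const, fun _ _ => measurable_const, measurable_const⟩
  | succ k ih =>
    obtain ⟨hb, hM, hz⟩ := ih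
    have hx : ∀ i, Measurable fun a => (ξ a k).ofLp i := fun i => by
      have := hξ k
      fun_prop
    have hz' : Measurable fun a => (traj τ β₀ M₀ βs (ξ a) (η a) (k + 1)).xiSq := by
      simp only [traj_xiSq_succ, predErr, err]
      have h1 := hξ k
      have h2 := hη k
      fun_prop
    have hg : Measurable fun a => phi τ (traj τ β₀ M₀ βs (ξ a) (η a) (k + 1)).xiSq :=
      (continuous_phi hτ).measurable.comp hz'
    have hMx : ∀ i, Measurable fun a =>
        (traj τ β₀ M₀ βs (ξ a) (η a) k).M.mulVec (ξ a k).ofLp i := fun i => by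
      simp only [Matrix.mulVec, dotProduct]
      exact Finset.measurable_sum _ fun j _ => (hM i j).mul (hx j)
    have hD : Measurable fun a => phi τ (traj τ β₀ M₀ βs (ξ a) (η a) (k + 1)).xiSq
        + (ξ a k).ofLp ⬝ᵥ ((traj τ β₀ M₀ βs (ξ a) (η a) k).M.mulVec (ξ a k).ofLp) := by
      simp only [dotProduct]
      exact hg.add (Finset.measurable_sum _ fun j _ => (hx j).mul (hMx j))
    refine ⟨?_, fun i j => ?_, hz'⟩
    · have hr : Measurable fun a => resid (traj τ β₀ M₀ βs (ξ a) (η a) k) (ξ a k)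
          ((ξ a k).ofLp ⬝ᵥ βs.ofLp + η a k) := by
        simp only [resid_traj, predErr, err]
        have h1 := hξ k
        have h2 := hη k
        fun_prop
      change Measurable fun a => nextBeta (phi τ (traj τ β₀ M₀ βs (ξ a) (η a) (k + 1)).xiSq)
        (traj τ β₀ M₀ βs (ξ a) (η a) k) (ξ a k) ((ξ a k).ofLp ⬝ᵥ βs.ofLp + η a k)
      unfold nextBeta
      refine hb.add ((hr.div hD).smul ?_)
      exact (WithLp.measurable_toLp 2 _).comp (measurable_pi_iff.2 hMx)
    · change Measurable fun a => nextM (phi τ (traj τ β₀ M₀ βs (ξ a) (η a) (k + 1)).xiSq)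
        (traj τ β₀ M₀ βs (ξ a) (η a) k) (ξ a k) i j
      simp only [nextM, Matrix.mul_apply, Matrix.sub_apply, Matrix.smul_apply, smul_eq_mul,
        Matrix.vecMulVec_apply]
      refine Finset.measurable_sum _ fun l _ => ?_
      refine (measurable_const.sub (hD.inv.mul ?_)).mul (hM l j)
      exact Finset.measurable_sum _ fun m _ => (hM i m).mul ((hx m).mul (hx l))

theorem measurable_err (hτ : 1 ≤ τ) (hξ : ∀ i, Measurable fun a => ξ a i)
    (hη : ∀ i, Measurable fun a => η a i) (k : ℕ) :
    Measurable fun a => err τ β₀ M₀ βs (ξ a) (η a) k :=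
  (measurable_traj β₀ M₀ βs hτ hξ hη k).1.sub_const _

theorem measurable_predErr (hτ : 1 ≤ τ) (hξ : ∀ i, Measurable fun a => ξ a i)
    (hη : ∀ i, Measurable fun a => η a i) (k : ℕ) :
    Measurable fun a => predErr τ β₀ M₀ βs (ξ a) (η a) k :=
  (hξ k).inner (measurable_err β₀ M₀ βs hτ hξ hη k)

theorem measurable_xiSq_traj (hτ : 1 ≤ τ) (hξ : ∀ i, Measurable fun a => ξ a i)
    (hη : ∀ i, Measurable fun a => η a i) (k : ℕ) :
    Measurable fun a => (traj τ β₀ M₀ βs (ξ a) (η a) k).xiSq :=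
  (measurable_traj β₀ M₀ βs hτ hξ hη k).2.2

theorem measurable_weight (hτ : 1 ≤ τ) (hξ : ∀ i, Measurable fun a => ξ a i)
    (hη : ∀ i, Measurable fun a => η a i) (k : ℕ) :
    Measurable fun a => weight τ β₀ M₀ βs (ξ a) (η a) k :=
  ((continuous_phi hτ).measurable.comp (measurable_xiSq_traj β₀ M₀ βs hτ hξ hη (k + 1))).inv

end Measurability

end Trajectory

/-! ### Averages of real sequences -/

theorem tendsto_sum_mul_div_of_tendsto_zero {w a : ℕ → ℝ} {B : ℝ} (hw : ∀ i, 0 ≤ w i)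
    (hB : ∀ k : ℕ, ∑ i ∈ Finset.range k, w i ≤ B * k) (ha : Tendsto a atTop (𝓝 0)) :
    Tendsto (fun k : ℕ => (∑ i ∈ Finset.range k, w i * a i) / k) atTop (𝓝 0) := by
  have hsum : ∀ k : ℕ, ∑ i ∈ Finset.range k, (w i + 1) = ∑ i ∈ Finset.range k, w i + k :=
    fun k => by simp [Finset.sum_add_distrib]
  -- Adding `1` to the weights makes their sums diverge, as summation of little-o relations
  -- requires, even if the `w i` are summable.
  have h1 : (fun i => w i * a i) =o[atTop] fun i => w i + 1 := by
    have h2 : (fun i => w i * a i) =O[atTop] fun i => (w i + 1) * a i := by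
      refine Asymptotics.IsBigO.of_bound 1 (Eventually.of_forall fun i => ?_)
      rw [one_mul, norm_mul, norm_mul, Real.norm_of_nonneg (hw i),
        Real.norm_of_nonneg (add_nonneg (hw i) zero_le_one)]
      gcongr
      linarith
    refine h2.trans_isLittleO ?_
    simpa using (Asymptotics.isBigO_refl (fun i => w i + 1) atTop).mul_isLittleO
      ((Asymptotics.isLittleO_one_iff ℝ).2 ha)
  have h3 := h1.sum_range (fun i => add_nonneg (hw i) zero_le_one) (by
    refine tendsto_atTop_mono (fun k => ?_) tendsto_natCast_atTop_atTop
    rw [hsum]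
    exact le_add_of_nonneg_left (Finset.sum_nonneg fun i _ => hw i))
  have h4 : (fun k => ∑ i ∈ Finset.range k, (w i + 1)) =O[atTop] fun k : ℕ => (k : ℝ) := by
    refine Asymptotics.IsBigO.of_bound (B + 1) (Eventually.of_forall fun k => ?_)
    rw [Real.norm_of_nonneg (Finset.sum_nonneg fun i _ => add_nonneg (hw i) zero_le_one),
      Real.norm_of_nonneg (Nat.cast_nonneg k), hsum]
    linarith [hB k]
  exact (h3.trans_isBigO h4).tendsto_div_nhds_zero

theorem exists_sum_le_mul_of_tendsto {w : ℕ → ℝ} {m : ℝ}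
    (h : Tendsto (fun k : ℕ => (∑ i ∈ Finset.range k, w i) / k) atTop (𝓝 m)) :
    ∃ B, ∀ k : ℕ, ∑ i ∈ Finset.range k, w i ≤ B * k := by
  obtain ⟨B, hB⟩ := h.bddAbove_range
  refine ⟨B, fun k => ?_⟩
  rcases Nat.eq_zero_or_pos k with rfl | hk
  · simp
  · rw [← div_le_iff₀ (by exact_mod_cast hk)]
    exact hB ⟨k, rfl⟩

/-- The quotient is the average over `k + 1` terms minus `k/(k+1)` times the average over `k` terms.
-/
theorem tendsto_div_succ_of_tendsto_average {w : ℕ → ℝ} {m : ℝ}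
    (h : Tendsto (fun k : ℕ => (∑ i ∈ Finset.range k, w i) / k) atTop (𝓝 m)) :
    Tendsto (fun k : ℕ => w k / ((k : ℝ) + 1)) atTop (𝓝 0) := by
  have h1 := h.comp (tendsto_add_atTop_nat 1)
  have h2 := h.mul (tendsto_natCast_div_add_atTop (1 : ℝ))
  have h3 := h1.sub h2
  rw [mul_one, sub_self] at h3
  refine h3.congr fun k => ?_
  simp only [Function.comp, Finset.sum_range_succ]
  push_cast
  rcases Nat.eq_zero_or_pos k with rfl | hk
  · simp
  · field_simp
    ring

/-! ### Noise moments along a fixed design -/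

/-- Centred i.i.d. noise of variance `σ²`. -/
structure IsNoise {Ω : Type*} [MeasurableSpace Ω] (P : Measure Ω) (ε : ℕ → Ω → ℝ) (σ : ℝ) :
    Prop where
  measurable : ∀ i, Measurable (ε i)
  indep : iIndepFun ε P
  identDistrib : ∀ i, IdentDistrib (ε i) (ε 0) P P
  memLp : ∀ i, MemLp (ε i) 2 P
  integral_eq : ∀ i, ∫ ω, ε i ω ∂P = 0
  integral_sq : ∀ i, ∫ ω, ε i ω ^ 2 ∂P = σ ^ 2

section Noise

variable {Ω : Type*} [MeasurableSpace Ω] {P : Measure Ω} {ε : ℕ → Ω → ℝ} {σ : ℝ}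

theorem IsNoise.integrable_sq (h : IsNoise P ε σ) (i : ℕ) : Integrable (fun ω => ε i ω ^ 2) P :=
  (h.memLp i).integrable_sq

namespace IsNoise

/-- A functional of the first `k` noise variables is independent of the next one. -/
theorem indepFun_of_dependsOn {γ : Type*} [MeasurableSpace γ] (h : IsNoise P ε σ) {k : ℕ}
    {W : (ℕ → ℝ) → γ} (hW : Measurable W) (hdep : ∀ e e', (∀ i < k, e i = e' i) → W e = W e') :
    IndepFun (fun ω => W fun i => ε i ω) (ε k) P := by
  have h1 := h.indep.indepFun_finset (Finset.range k) {k} (by simp) h.measurable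
  -- Padding by zeros turns `W` into a function of the finite block, without changing its value.
  let ext : (Finset.range k → ℝ) → ℕ → ℝ := fun v i =>
    if hi : i ∈ Finset.range k then v ⟨i, hi⟩ else 0
  have hext : Measurable ext := by
    refine measurable_pi_iff.2 fun i => ?_
    by_cases hi : i ∈ Finset.range k
    · simp only [ext, dif_pos hi]; exact measurable_pi_apply _
    · simp only [ext, dif_neg hi]; exact measurable_const
  have h2 := h1.comp (hW.comp hext)
    (measurable_pi_apply (⟨k, Finset.mem_singleton_self k⟩ : ({k} : Finset ℕ)))
  refine (congrArg (fun f => IndepFun f (ε k) P) (funext fun ω => ?_)).mpr h2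
  refine hdep _ _ fun i hi => ?_
  simp [ext, hi]

theorem integral_mul_sq (h : IsNoise P ε σ) {k : ℕ} {W : (ℕ → ℝ) → ℝ} (hW : Measurable W)
    (hdep : ∀ e e', (∀ i < k, e i = e' i) → W e = W e') :
    ∫ ω, W (fun i => ε i ω) * ε k ω ^ 2 ∂P = (∫ ω, W (fun i => ε i ω) ∂P) * σ ^ 2 := by
  have hi := (h.indepFun_of_dependsOn hW hdep).comp measurable_id (measurable_id.pow_const 2)
  rw [← h.integral_sq k]
  exact hi.integral_fun_mul_eq_mul_integral
    (hW.comp (measurable_pi_iff.2 h.measurable)).aestronglyMeasurable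
    ((h.measurable k).pow_const 2).aestronglyMeasurable

theorem integrable_mul_sq (h : IsNoise P ε σ) {k : ℕ} {W : (ℕ → ℝ) → ℝ} (hW : Measurable W)
    (hdep : ∀ e e', (∀ i < k, e i = e' i) → W e = W e')
    (hint : Integrable (fun ω => W fun i => ε i ω) P) :
    Integrable (fun ω => W (fun i => ε i ω) * ε k ω ^ 2) P :=
  ((h.indepFun_of_dependsOn hW hdep).comp measurable_id
    (measurable_id.pow_const 2)).integrable_mul hint (h.integrable_sq k)

theorem integral_mul (h : IsNoise P ε σ) {k : ℕ} {W : (ℕ → ℝ) → ℝ} (hW : Measurable W)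
    (hdep : ∀ e e', (∀ i < k, e i = e' i) → W e = W e') :
    ∫ ω, W (fun i => ε i ω) * ε k ω ∂P = 0 := by
  have := (h.indepFun_of_dependsOn hW hdep).integral_fun_mul_eq_mul_integral
    (hW.comp (measurable_pi_iff.2 h.measurable)).aestronglyMeasurable
    (h.measurable k).aestronglyMeasurable
  rw [this, h.integral_eq, mul_zero]

variable [IsProbabilityMeasure P]

theorem integrable (h : IsNoise P ε σ) (i : ℕ) : Integrable (ε i) P :=
  (h.memLp i).integrable one_le_two

theorem integrable_mul (h : IsNoise P ε σ) {k : ℕ} {W : (ℕ → ℝ) → ℝ} (hW : Measurable W)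
    (hdep : ∀ e e', (∀ i < k, e i = e' i) → W e = W e')
    (hint : Integrable (fun ω => W fun i => ε i ω) P) :
    Integrable (fun ω => W (fun i => ε i ω) * ε k ω) P :=
  (h.indepFun_of_dependsOn hW hdep).integrable_mul hint (h.integrable k)

end IsNoise

variable [IsProbabilityMeasure P]

theorem LinearModel.isNoise {n : ℕ} {X : ℕ → Ω → EuclideanSpace ℝ (Fin n)} {Y : ℕ → Ω → ℝ}
    {βs : EuclideanSpace ℝ (Fin n)} (h : LinearModel P X Y ε βs σ) : IsNoise P ε σ where
  measurable := h.measurable_noise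
  indep := h.indep_noise
  identDistrib := h.identDistrib_noise
  memLp := h.memLp_noise
  integral_eq := h.mean_noise
  integral_sq i := by
    rw [← h.variance_noise i, variance_eq_sub (h.memLp_noise i), h.mean_noise i]
    simp

section Design

variable {n : ℕ} {τ : ℕ} (β₀ : EuclideanSpace ℝ (Fin n)) {M₀ : Matrix (Fin n) (Fin n) ℝ}
  (βs : EuclideanSpace ℝ (Fin n)) (x : ℕ → EuclideanSpace ℝ (Fin n))

theorem sq_predErr_le (e : ℕ → ℝ) (k : ℕ) :
    predErr τ β₀ M₀ βs x e k ^ 2 ≤ ‖x k‖ ^ 2 * ‖err τ β₀ M₀ βs x e k‖ ^ 2 := by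
  rw [← mul_pow, ← sq_abs, predErr]
  gcongr
  exact abs_real_inner_le_norm _ _

theorem integrable_sq_norm_err (h : IsNoise P ε σ) (hτ : 1 ≤ τ) (hM₀ : M₀.PosDef) (k : ℕ) :
    Integrable (fun ω => ‖err τ β₀ M₀ βs x (fun i => ε i ω) k‖ ^ 2) P := by
  obtain ⟨c, hc, hle⟩ := exists_pos_mul_norm_err_le β₀ βs hτ hM₀
  have hm := measurable_err β₀ M₀ βs hτ (ξ := fun _ : Ω => x) (η := fun ω i => ε i ω)
    (fun _ => measurable_const) h.measurable k
  refine Integrable.mono' (g := fun ω => (c ^ 2)⁻¹ * (2 * ‖precOp M₀ (β₀ - βs)‖ ^ 2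
    + 2 * τ ^ 2 * (∑ i ∈ Finset.range k, ‖x i‖ ^ 2) * ∑ i ∈ Finset.range k, ε i ω ^ 2)) ?_
    (hm.norm.pow_const 2).aestronglyMeasurable (Eventually.of_forall fun ω => ?_)
  · exact ((integrable_const _).add
      ((integrable_finsetSum _ fun i _ => h.integrable_sq i).const_mul _)).const_mul _
  · rw [Real.norm_of_nonneg (by positivity), le_inv_mul_iff₀ (by positivity), ← mul_pow]
    refine le_trans ?_ (sq_norm_score_le β₀ βs x _ hτ k)
    gcongr
    exact hle _ _ _

theorem integrable_sq_predErr (h : IsNoise P ε σ) (hτ : 1 ≤ τ) (hM₀ : M₀.PosDef) (k : ℕ) :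
    Integrable (fun ω => predErr τ β₀ M₀ βs x (fun i => ε i ω) k ^ 2) P := by
  have hm := measurable_predErr β₀ M₀ βs hτ (ξ := fun _ : Ω => x) (η := fun ω i => ε i ω)
    (fun _ => measurable_const) h.measurable k
  refine ((integrable_sq_norm_err β₀ βs x h hτ hM₀ k).const_mul (‖x k‖ ^ 2)).mono'
    (hm.pow_const 2).aestronglyMeasurable (Eventually.of_forall fun ω => ?_)
  rw [Real.norm_of_nonneg (sq_nonneg _)]
  exact sq_predErr_le _ _ _ _ _

theorem integral_sq_predErr_le (h : IsNoise P ε σ) (hτ : 1 ≤ τ) (hM₀ : M₀.PosDef) (k : ℕ) :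
    ∫ ω, predErr τ β₀ M₀ βs x (fun i => ε i ω) k ^ 2 ∂P
      ≤ ‖x k‖ ^ 2 * ∫ ω, ‖err τ β₀ M₀ βs x (fun i => ε i ω) k‖ ^ 2 ∂P := by
  rw [← integral_const_mul]
  exact integral_mono (integrable_sq_predErr β₀ βs x h hτ hM₀ k)
    ((integrable_sq_norm_err β₀ βs x h hτ hM₀ k).const_mul _) fun ω => sq_predErr_le _ _ _ _ _

theorem measurable_predErr_noise (hτ : 1 ≤ τ) (k : ℕ) :
    Measurable fun e => predErr τ β₀ M₀ βs x e k :=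
  measurable_predErr β₀ M₀ βs hτ (ξ := fun _ => x) (η := fun e => e)
    (fun _ => measurable_const) measurable_pi_apply k

theorem integrable_predErr (h : IsNoise P ε σ) (hτ : 1 ≤ τ) (hM₀ : M₀.PosDef) (k : ℕ) :
    Integrable (fun ω => predErr τ β₀ M₀ βs x (fun i => ε i ω) k) P :=
  ((memLp_two_iff_integrable_sq (((measurable_predErr_noise β₀ βs x hτ k).comp
    (measurable_pi_iff.2 h.measurable)).aestronglyMeasurable)).2
    (integrable_sq_predErr β₀ βs x h hτ hM₀ k)).integrable one_le_two

/-- The cross term has mean zero because the prediction error is independent of the centred variable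
`ε k`. -/
theorem integral_sq_resid (h : IsNoise P ε σ) (hτ : 1 ≤ τ) (hM₀ : M₀.PosDef) (k : ℕ) :
    Integrable (fun ω => (ε k ω - predErr τ β₀ M₀ βs x (fun i => ε i ω) k) ^ 2) P ∧
    ∫ ω, (ε k ω - predErr τ β₀ M₀ βs x (fun i => ε i ω) k) ^ 2 ∂P
      = σ ^ 2 + ∫ ω, predErr τ β₀ M₀ βs x (fun i => ε i ω) k ^ 2 ∂P := by
  have hdep : ∀ e e' : ℕ → ℝ, (∀ i < k, e i = e' i) →
      predErr τ β₀ M₀ βs x e k = predErr τ β₀ M₀ βs x e' k :=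
    fun e e' he => predErr_congr _ _ _ _ (fun _ _ => rfl) he
  have hm := measurable_predErr_noise β₀ (M₀ := M₀) βs x hτ k
  have h0 := h.integral_mul hm hdep
  have hi := h.integrable_mul hm hdep (integrable_predErr β₀ βs x h hτ hM₀ k)
  have hi1 := h.integrable_sq k
  have hi2 := integrable_sq_predErr β₀ βs x h hτ hM₀ k
  have heq : (fun ω => (ε k ω - predErr τ β₀ M₀ βs x (fun i => ε i ω) k) ^ 2)
      = fun ω => (ε k ω ^ 2 + predErr τ β₀ M₀ βs x (fun i => ε i ω) k ^ 2)
        - 2 * (predErr τ β₀ M₀ βs x (fun i => ε i ω) k * ε k ω) := by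
    funext ω; ring
  have hi12 : Integrable (fun ω => ε k ω ^ 2 + predErr τ β₀ M₀ βs x (fun i => ε i ω) k ^ 2) P :=
    hi1.add hi2
  rw [heq]
  refine ⟨hi12.sub (hi.const_mul 2), ?_⟩
  rw [integral_sub hi12 (hi.const_mul 2), integral_const_mul, h0, integral_add hi1 hi2,
    h.integral_sq]
  ring

theorem integral_xiSq (h : IsNoise P ε σ) (hτ : 1 ≤ τ) (hM₀ : M₀.PosDef) (k : ℕ) :
    Integrable (fun ω => (traj τ β₀ M₀ βs x (fun i => ε i ω) k).xiSq) P ∧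
    ∫ ω, (traj τ β₀ M₀ βs x (fun i => ε i ω) k).xiSq ∂P
      = (∑ i ∈ Finset.range k,
          (σ ^ 2 + ∫ ω, predErr τ β₀ M₀ βs x (fun j => ε j ω) i ^ 2 ∂P)) / k := by
  have hr := fun i => integral_sq_resid β₀ βs x h hτ hM₀ i
  simp only [traj_xiSq]
  refine ⟨(integrable_finsetSum _ fun i _ => (hr i).1).div_const _, ?_⟩
  rw [integral_div, integral_finsetSum _ fun i _ => (hr i).1]
  exact congrArg (· / (k : ℝ)) (Finset.sum_congr rfl fun i _ => (hr i).2)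

end Design

end Noise

/-! ### Predictable weights and the two-pass error bound -/

section Design

variable {n : ℕ} (τ : ℕ) (β₀ : EuclideanSpace ℝ (Fin n)) (M₀ : Matrix (Fin n) (Fin n) ℝ)
  (βs : EuclideanSpace ℝ (Fin n)) (x : ℕ → EuclideanSpace ℝ (Fin n)) (e : ℕ → ℝ)

/-- The weight that step `k + 1` would use if the new squared residual were dropped; it does not
depend on `e k`. -/
noncomputable def predWeight (k : ℕ) : ℝ :=
  (phi τ ((1 - 1 / ((k : ℝ) + 1)) * (traj τ β₀ M₀ βs x e k).xiSq))⁻¹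

/-- The part of the score driven by predictable weights. -/
noncomputable def martScore (k : ℕ) : EuclideanSpace ℝ (Fin n) :=
  ∑ i ∈ Finset.range k, (predWeight τ β₀ M₀ βs x e i * e i) • x i

theorem predWeight_congr {e e' : ℕ → ℝ} {k : ℕ} (he : ∀ i < k, e i = e' i) :
    predWeight τ β₀ M₀ βs x e k = predWeight τ β₀ M₀ βs x e' k := by
  rw [predWeight, predWeight, traj_congr τ β₀ M₀ βs (fun _ _ => rfl) he]

theorem martScore_congr {e e' : ℕ → ℝ} {k : ℕ} (he : ∀ i < k, e i = e' i) :
    martScore τ β₀ M₀ βs x e k = martScore τ β₀ M₀ βs x e' k := by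
  refine Finset.sum_congr rfl fun i hi => ?_
  rw [Finset.mem_range] at hi
  rw [predWeight_congr τ β₀ M₀ βs x (fun j hj => he j (hj.trans hi)), he i hi]

variable {τ}

theorem measurable_predWeight (hτ : 1 ≤ τ) (k : ℕ) :
    Measurable fun e => predWeight τ β₀ M₀ βs x e k := by
  have h := measurable_xiSq_traj β₀ M₀ βs hτ (ξ := fun _ => x) (η := fun e => e)
    (fun _ => measurable_const) measurable_pi_apply k
  exact ((continuous_phi hτ).measurable.comp (h.const_mul _)).inv

theorem measurable_martScore (hτ : 1 ≤ τ) (k : ℕ) :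
    Measurable fun e => martScore τ β₀ M₀ βs x e k :=
  Finset.measurable_sum _ fun i _ =>
    ((measurable_predWeight β₀ M₀ βs x hτ i).mul (measurable_pi_apply i)).smul_const _

theorem predWeight_nonneg (hτ : 1 ≤ τ) (k : ℕ) : 0 ≤ predWeight τ β₀ M₀ βs x e k :=
  (inv_pos.2 (phi_pos hτ _)).le

theorem predWeight_le (hτ : 1 ≤ τ) (k : ℕ) : predWeight τ β₀ M₀ βs x e k ≤ τ :=
  inv_phi_le hτ _

/-- The two arguments of `φ_τ` differ by exactly `r²/(k+1)`, and both values lie in `[1/τ, τ]`. The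
minimum is kept because only second moments of the noise are available: multiplied by `ε²`, the
quotient alone would call for a fourth moment. -/
theorem abs_weight_sub_predWeight_le (hτ : 1 ≤ τ) (k : ℕ) :
    |weight τ β₀ M₀ βs x e k - predWeight τ β₀ M₀ βs x e k|
      ≤ τ ^ 2 * min (τ : ℝ) ((e k - predErr τ β₀ M₀ βs x e k) ^ 2 / ((k : ℝ) + 1)) := by
  have hk : (0 : ℝ) < (k : ℝ) + 1 := by positivity
  set g := phi τ (traj τ β₀ M₀ βs x e (k + 1)).xiSq
  set g' := phi τ ((1 - 1 / ((k : ℝ) + 1)) * (traj τ β₀ M₀ βs x e k).xiSq)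
  have h0 : 0 < g := phi_pos hτ _
  have h0' : 0 < g' := phi_pos hτ _
  have h1 : |g' - g| ≤ τ := by
    rw [abs_sub_le_iff]
    exact ⟨by linarith [phi_le hτ ((1 - 1 / ((k : ℝ) + 1)) * (traj τ β₀ M₀ βs x e k).xiSq)],
      by linarith [phi_le hτ (traj τ β₀ M₀ βs x e (k + 1)).xiSq]⟩
  have h2 : |g' - g| ≤ (e k - predErr τ β₀ M₀ βs x e k) ^ 2 / ((k : ℝ) + 1) := by
    rw [abs_sub_comm]
    refine (abs_phi_sub_phi_le hτ _ _).trans (le_of_eq ?_)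
    rw [traj_xiSq_succ, add_sub_cancel_right, abs_of_nonneg (by positivity)]
    ring
  have h3 : weight τ β₀ M₀ βs x e k - predWeight τ β₀ M₀ βs x e k = g⁻¹ * g'⁻¹ * (g' - g) := by
    change g⁻¹ - g'⁻¹ = _
    field_simp
  rw [h3, abs_mul, abs_of_nonneg (by positivity), sq]
  exact mul_le_mul (mul_le_mul (inv_phi_le hτ _) (inv_phi_le hτ _) (by positivity)
    (by positivity)) (le_min h1 h2) (abs_nonneg _) (by positivity)

/-- Writing `m` for the minimum, `m² ≤ τ m` and `r² ≤ 2ε² + 2u²`, where `u` is the prediction error,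
separate a term in `ε` alone from a product of independent factors. -/
theorem sq_weight_sub_mul_le (hτ : 1 ≤ τ) (k : ℕ) :
    ((weight τ β₀ M₀ βs x e k - predWeight τ β₀ M₀ βs x e k) * e k) ^ 2
      ≤ τ ^ 5 * (min (τ : ℝ) (2 * e k ^ 2 / ((k : ℝ) + 1)) * e k ^ 2
        + 2 / ((k : ℝ) + 1) * (predErr τ β₀ M₀ βs x e k ^ 2 * e k ^ 2)) := by
  set u := predErr τ β₀ M₀ βs x e k
  have hk : (0 : ℝ) < (k : ℝ) + 1 := by positivity
  have h := abs_weight_sub_predWeight_le β₀ M₀ βs x e hτ k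
  have hr : (e k - u) ^ 2 / ((k : ℝ) + 1)
      ≤ 2 * e k ^ 2 / ((k : ℝ) + 1) + 2 / ((k : ℝ) + 1) * u ^ 2 := by
    rw [div_mul_eq_mul_div, ← add_div]
    gcongr
    nlinarith [sq_nonneg (e k + u)]
  have hb : 0 ≤ 2 / ((k : ℝ) + 1) * u ^ 2 := by positivity
  set m := min (τ : ℝ) ((e k - u) ^ 2 / ((k : ℝ) + 1))
  have hm0 : 0 ≤ m := le_min (by positivity) (by positivity)
  have hmτ : m ≤ τ := min_le_left _ _
  have hm : m ≤ min (τ : ℝ) (2 * e k ^ 2 / ((k : ℝ) + 1)) + 2 / ((k : ℝ) + 1) * u ^ 2 := by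
    rcases le_total (τ : ℝ) (2 * e k ^ 2 / ((k : ℝ) + 1)) with h' | h'
    · rw [min_eq_left h']; linarith
    · rw [min_eq_right h']; exact (min_le_right _ _).trans hr
  calc _ = |weight τ β₀ M₀ βs x e k - predWeight τ β₀ M₀ βs x e k| ^ 2 * e k ^ 2 := by
        rw [mul_pow, sq_abs]
    _ ≤ (τ ^ 2 * m) ^ 2 * e k ^ 2 := by gcongr
    _ = τ ^ 4 * (m * m) * e k ^ 2 := by ring
    _ ≤ τ ^ 4 * (τ * (min (τ : ℝ) (2 * e k ^ 2 / ((k : ℝ) + 1)) + 2 / ((k : ℝ) + 1) * u ^ 2))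
          * e k ^ 2 := by gcongr
    _ = _ := by ring

/-- The score splits into initial value, martingale and weight correction. Only the correction is
treated by Cauchy–Schwarz. -/
theorem sq_norm_score_le_martScore (k : ℕ) :
    ‖score β₀ βs x e τ M₀ k‖ ^ 2 ≤ 3 * ‖precOp M₀ (β₀ - βs)‖ ^ 2
      + 3 * ‖martScore τ β₀ M₀ βs x e k‖ ^ 2
      + 3 * (∑ i ∈ Finset.range k, ‖x i‖ ^ 2) * ∑ i ∈ Finset.range k,
        ((weight τ β₀ M₀ βs x e i - predWeight τ β₀ M₀ βs x e i) * e i) ^ 2 := by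
  set R := ∑ i ∈ Finset.range k,
    ((weight τ β₀ M₀ βs x e i - predWeight τ β₀ M₀ βs x e i) * e i) • x i with hR
  have hs : score β₀ βs x e τ M₀ k
      = precOp M₀ (β₀ - βs) + martScore τ β₀ M₀ βs x e k + R := by
    rw [score, martScore, hR, add_assoc, ← Finset.sum_add_distrib]
    congr 1
    refine Finset.sum_congr rfl fun i _ => ?_
    module
  have h1 : ‖R‖ ≤ ∑ i ∈ Finset.range k, ‖x i‖ *
      |(weight τ β₀ M₀ βs x e i - predWeight τ β₀ M₀ βs x e i) * e i| := by
    refine (norm_sum_le _ _).trans (Finset.sum_le_sum fun i _ => ?_)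
    rw [norm_smul, Real.norm_eq_abs, mul_comm]
  have h2 := Finset.sum_mul_sq_le_sq_mul_sq (Finset.range k) (fun i => ‖x i‖)
    (fun i => |(weight τ β₀ M₀ βs x e i - predWeight τ β₀ M₀ βs x e i) * e i|)
  simp only [sq_abs] at h2
  have h3 := norm_add₃_le (a := precOp M₀ (β₀ - βs)) (b := martScore τ β₀ M₀ βs x e k) (c := R)
  have h4 : ‖R‖ ^ 2 ≤ _ := (pow_le_pow_left₀ (norm_nonneg _) h1 2).trans h2
  rw [hs, mul_assoc 3]
  refine (pow_le_pow_left₀ (norm_nonneg _) h3 2).trans ?_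
  set a := ‖precOp M₀ (β₀ - βs)‖
  set b := ‖martScore τ β₀ M₀ βs x e k‖
  nlinarith [sq_nonneg (a - b), sq_nonneg (a - ‖R‖), sq_nonneg (b - ‖R‖)]

end Design

section Noise

variable {Ω : Type*} [MeasurableSpace Ω] {P : Measure Ω} [IsProbabilityMeasure P]
  {ε : ℕ → Ω → ℝ} {σ : ℝ} {n : ℕ} {τ : ℕ} (β₀ : EuclideanSpace ℝ (Fin n))
  {M₀ : Matrix (Fin n) (Fin n) ℝ}
  (βs : EuclideanSpace ℝ (Fin n)) {x : ℕ → EuclideanSpace ℝ (Fin n)}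

/-- Orthogonality of martingale increments: the growth is linear in the design energy. -/
theorem integral_sq_norm_martScore_le (x) (h : IsNoise P ε σ) (hτ : 1 ≤ τ) (k : ℕ) :
    Integrable (fun ω => ‖martScore τ β₀ M₀ βs x (fun i => ε i ω) k‖ ^ 2) P ∧
    ∫ ω, ‖martScore τ β₀ M₀ βs x (fun i => ε i ω) k‖ ^ 2 ∂P
      ≤ τ ^ 2 * σ ^ 2 * ∑ i ∈ Finset.range k, ‖x i‖ ^ 2 := by
  induction k with
  | zero => simp [martScore]
  | succ k ih =>
    obtain ⟨hi, hle⟩ := ih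
    let W₁ : (ℕ → ℝ) → ℝ := fun e =>
      predWeight τ β₀ M₀ βs x e k * ⟪martScore τ β₀ M₀ βs x e k, x k⟫
    let W₂ : (ℕ → ℝ) → ℝ := fun e => predWeight τ β₀ M₀ βs x e k ^ 2 * ‖x k‖ ^ 2
    have hmε : Measurable fun ω i => ε i ω := measurable_pi_iff.2 h.measurable
    have hmw := measurable_predWeight β₀ M₀ βs x hτ k
    have hmm := measurable_martScore β₀ M₀ βs x hτ k
    have hW₁ : Measurable W₁ := hmw.mul (hmm.inner measurable_const)
    have hW₂ : Measurable W₂ := (hmw.pow_const 2).mul_const _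
    have hd₁ : ∀ e e' : ℕ → ℝ, (∀ i < k, e i = e' i) → W₁ e = W₁ e' := fun e e' he => by
      simp only [W₁, predWeight_congr τ β₀ M₀ βs x he, martScore_congr τ β₀ M₀ βs x he]
    have hd₂ : ∀ e e' : ℕ → ℝ, (∀ i < k, e i = e' i) → W₂ e = W₂ e' := fun e e' he => by
      simp only [W₂, predWeight_congr τ β₀ M₀ βs x he]
    have hb₂ : ∀ e, W₂ e ≤ τ ^ 2 * ‖x k‖ ^ 2 := fun e => by
      have h1 := predWeight_nonneg β₀ M₀ βs x e hτ k
      have h2 := predWeight_le β₀ M₀ βs x e hτ k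
      simp only [W₂]
      gcongr
    have hi₂ : Integrable (fun ω => W₂ fun i => ε i ω) P := by
      refine (integrable_const (τ ^ 2 * ‖x k‖ ^ 2 : ℝ)).mono'
        (hW₂.comp hmε).aestronglyMeasurable (Eventually.of_forall fun ω => ?_)
      rw [Real.norm_of_nonneg (by positivity)]
      exact hb₂ _
    -- With `N` the norm of the martingale, `N ≤ N² + 1` reduces this to the second moment from the
    -- induction hypothesis.
    have hi₁ : Integrable (fun ω => W₁ fun i => ε i ω) P := by
      refine ((hi.add (integrable_const (1 : ℝ))).const_mul (τ * ‖x k‖)).mono'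
        (hW₁.comp hmε).aestronglyMeasurable (Eventually.of_forall fun ω => ?_)
      have h1 := predWeight_nonneg β₀ M₀ βs x (fun i => ε i ω) hτ k
      have h2 := predWeight_le β₀ M₀ βs x (fun i => ε i ω) hτ k
      have h3 := abs_real_inner_le_norm (martScore τ β₀ M₀ βs x (fun i => ε i ω) k) (x k)
      simp only [W₁, Real.norm_eq_abs, abs_mul, abs_of_nonneg h1, Pi.add_apply]
      set N := ‖martScore τ β₀ M₀ βs x (fun i => ε i ω) k‖
      calc _ ≤ τ * (N * ‖x k‖) := by gcongr
        _ = τ * ‖x k‖ * N := by ring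
        _ ≤ _ := by
          gcongr
          nlinarith [sq_nonneg (N - 1), sq_nonneg N]
    have hexp : ∀ e : ℕ → ℝ, ‖martScore τ β₀ M₀ βs x e (k + 1)‖ ^ 2
        = ‖martScore τ β₀ M₀ βs x e k‖ ^ 2 + 2 * (W₁ e * e k) + W₂ e * e k ^ 2 := fun e => by
      rw [martScore, Finset.sum_range_succ, ← martScore, norm_add_sq_real, inner_smul_right,
        norm_smul, mul_pow, Real.norm_eq_abs, sq_abs]
      simp only [W₁, W₂]
      ring
    have hj₁ := (h.integrable_mul hW₁ hd₁ hi₁).const_mul 2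
    have hj₂ := h.integrable_mul_sq hW₂ hd₂ hi₂
    have hj₃ : Integrable (fun ω => ‖martScore τ β₀ M₀ βs x (fun i => ε i ω) k‖ ^ 2
        + 2 * (W₁ (fun i => ε i ω) * ε k ω)) P := hi.add hj₁
    simp only [hexp]
    refine ⟨hj₃.add hj₂, ?_⟩
    rw [integral_add hj₃ hj₂, integral_add hi hj₁, integral_const_mul, h.integral_mul hW₁ hd₁,
      h.integral_mul_sq hW₂ hd₂, Finset.sum_range_succ]
    have : ∫ ω, W₂ (fun i => ε i ω) ∂P ≤ τ ^ 2 * ‖x k‖ ^ 2 := by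
      calc _ ≤ ∫ _, (τ ^ 2 * ‖x k‖ ^ 2 : ℝ) ∂P :=
          integral_mono hi₂ (integrable_const _) fun ω => hb₂ _
        _ = _ := by simp
    nlinarith [mul_le_mul_of_nonneg_right this (sq_nonneg σ)]

/-- A bound on the score gives a bound on the mean squared estimation error. -/
theorem mul_integral_sq_norm_err_le (h : IsNoise P ε σ) (hτ : 1 ≤ τ) (hM₀ : M₀.PosDef) {c : ℝ}
    (hc : 0 ≤ c) {k : ℕ} (hv : ∀ v, c * ‖v‖ ^ 2 ≤ ∑ i ∈ Finset.range k, ⟪x i, v⟫ ^ 2)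
    {G : Ω → ℝ} (hG : Integrable G P)
    (hle : ∀ ω, ‖score β₀ βs x (fun i => ε i ω) τ M₀ k‖ ^ 2 ≤ G ω) :
    ((τ : ℝ)⁻¹ * c) ^ 2 * ∫ ω, ‖err τ β₀ M₀ βs x (fun i => ε i ω) k‖ ^ 2 ∂P ≤ ∫ ω, G ω ∂P := by
  rw [← integral_const_mul]
  refine integral_mono ((integrable_sq_norm_err β₀ βs x h hτ hM₀ k).const_mul _) hG fun ω => ?_
  refine le_trans ?_ (hle ω)
  dsimp only
  rw [← mul_pow]
  gcongr
  exact mul_norm_err_le_of_le_sum β₀ βs x _ hτ hM₀ hv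

/-- First pass: the crude score bound and the square of the Gram bound are both of order `k²`. -/
theorem exists_eventually_integral_sq_norm_err_le (h : IsNoise P ε σ) (hτ : 1 ≤ τ)
    (hM₀ : M₀.PosDef) {B c : ℝ}
    (hB : ∀ k : ℕ, ∑ i ∈ Finset.range k, ‖x i‖ ^ 2 ≤ B * k) (hc : 0 < c)
    (hv : ∀ᶠ k : ℕ in atTop, ∀ v, c * k * ‖v‖ ^ 2 ≤ ∑ i ∈ Finset.range k, ⟪x i, v⟫ ^ 2) :
    ∃ C, ∀ᶠ k : ℕ in atTop,
      ∫ ω, ‖err τ β₀ M₀ βs x (fun i => ε i ω) k‖ ^ 2 ∂P ≤ C := by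
  have hτ' : (0 : ℝ) < τ := by exact_mod_cast hτ
  refine ⟨(2 * ‖precOp M₀ (β₀ - βs)‖ ^ 2 + 2 * τ ^ 2 * B * σ ^ 2) / ((τ : ℝ)⁻¹ * c) ^ 2, ?_⟩
  filter_upwards [hv, eventually_ge_atTop 1] with k hk hk1
  have hk1' : (1 : ℝ) ≤ k := by exact_mod_cast hk1
  have hsum := integrable_finsetSum (Finset.range k) fun i _ => h.integrable_sq i
  have := mul_integral_sq_norm_err_le β₀ βs h hτ hM₀ (c := c * k) (by positivity) hk
    ((integrable_const (2 * ‖precOp M₀ (β₀ - βs)‖ ^ 2)).add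
      (hsum.const_mul (2 * τ ^ 2 * ∑ i ∈ Finset.range k, ‖x i‖ ^ 2)))
    fun ω => sq_norm_score_le β₀ βs x _ hτ k
  simp only [Pi.add_apply] at this
  rw [integral_add (integrable_const _) (hsum.const_mul _), integral_const_mul,
    integral_const_mul, integral_finsetSum _ fun i _ => h.integrable_sq i] at this
  simp only [h.integral_sq, integral_const, probReal_univ, one_smul, Finset.sum_const,
    Finset.card_range, nsmul_eq_mul] at this
  rw [le_div_iff₀ (by positivity)]
  set a := ∫ ω, ‖err τ β₀ M₀ βs x (fun i => ε i ω) k‖ ^ 2 ∂P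
  set p := ‖precOp M₀ (β₀ - βs)‖
  have h1 : (a * ((τ : ℝ)⁻¹ * c) ^ 2) * k ^ 2 ≤ (2 * p ^ 2 + 2 * τ ^ 2 * B * σ ^ 2) * k ^ 2 := by
    calc _ = ((τ : ℝ)⁻¹ * (c * k)) ^ 2 * a := by ring
      _ ≤ _ := this
      _ ≤ 2 * p ^ 2 * k ^ 2 + 2 * τ ^ 2 * (B * k) * (k * σ ^ 2) := by
        refine add_le_add (le_mul_of_one_le_right (by positivity) (one_le_pow₀ hk1')) ?_
        gcongr
        exact hB k
      _ = _ := by ring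
  exact le_of_mul_le_mul_right h1 (by positivity)

end Noise

/-! ### Consistency and limits along a fixed design -/

section Noise

variable {Ω : Type*} [MeasurableSpace Ω] {P : Measure Ω} {ε : ℕ → Ω → ℝ} {σ : ℝ}

theorem IsNoise.integrable_min_mul_sq (h : IsNoise P ε σ) (τ : ℕ) (j : ℕ) (c : ℝ) (hc : 0 ≤ c) :
    Integrable (fun ω => min (τ : ℝ) (2 * ε j ω ^ 2 / c) * ε j ω ^ 2) P := by
  have hm := h.measurable j
  refine ((h.integrable_sq j).const_mul (τ : ℝ)).mono' (by fun_prop)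
    (Eventually.of_forall fun ω => ?_)
  rw [Real.norm_of_nonneg (by positivity)]
  gcongr
  exact min_le_left _ _

/-- Identical distribution moves every integral to `ε 0`, where `τ ε₀²` dominates. -/
theorem IsNoise.tendsto_integral_min_mul_sq (h : IsNoise P ε σ) (τ : ℕ) :
    Tendsto (fun j : ℕ => ∫ ω, min (τ : ℝ) (2 * ε j ω ^ 2 / ((j : ℝ) + 1)) * ε j ω ^ 2 ∂P) atTop
      (𝓝 0) := by
  have heq : ∀ j : ℕ, ∫ ω, min (τ : ℝ) (2 * ε j ω ^ 2 / ((j : ℝ) + 1)) * ε j ω ^ 2 ∂P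
      = ∫ ω, min (τ : ℝ) (2 * ε 0 ω ^ 2 / ((j : ℝ) + 1)) * ε 0 ω ^ 2 ∂P := fun j =>
    ((h.identDistrib j).comp (u := fun t : ℝ => min (τ : ℝ) (2 * t ^ 2 / ((j : ℝ) + 1)) * t ^ 2)
      (by fun_prop)).integral_eq
  simp only [heq]
  have hm := h.measurable 0
  rw [show (0 : ℝ) = ∫ _, (0 : ℝ) ∂P by simp]
  refine tendsto_integral_of_dominated_convergence (fun ω => τ * ε 0 ω ^ 2)
    (fun j => by fun_prop) ((h.integrable_sq 0).const_mul _)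
    (fun j => Eventually.of_forall fun ω => ?_)
    (Eventually.of_forall fun ω => ?_)
  · rw [Real.norm_of_nonneg (by positivity)]
    gcongr
    exact min_le_left _ _
  · have h1 : Tendsto (fun j : ℕ => 2 * ε 0 ω ^ 2 / ((j : ℝ) + 1)) atTop (𝓝 0) :=
      tendsto_const_nhds.div_atTop (tendsto_natCast_atTop_atTop.atTop_add tendsto_const_nhds)
    have h2 := ((tendsto_const_nhds (x := (τ : ℝ))).min h1).mul_const (ε 0 ω ^ 2)
    simpa using h2

variable [IsProbabilityMeasure P] {n : ℕ} {τ : ℕ} (β₀ : EuclideanSpace ℝ (Fin n))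
  {M₀ : Matrix (Fin n) (Fin n) ℝ} (βs : EuclideanSpace ℝ (Fin n))
  {x : ℕ → EuclideanSpace ℝ (Fin n)}

theorem tendsto_integral_sq_weight_sub_mul (h : IsNoise P ε σ) (hτ : 1 ≤ τ) (hM₀ : M₀.PosDef)
    (hu : Tendsto (fun j : ℕ => (∫ ω, predErr τ β₀ M₀ βs x (fun i => ε i ω) j ^ 2 ∂P)
      / ((j : ℝ) + 1)) atTop (𝓝 0)) :
    (∀ j, Integrable (fun ω => ((weight τ β₀ M₀ βs x (fun i => ε i ω) j
        - predWeight τ β₀ M₀ βs x (fun i => ε i ω) j) * ε j ω) ^ 2) P) ∧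
    Tendsto (fun j => ∫ ω, ((weight τ β₀ M₀ βs x (fun i => ε i ω) j
        - predWeight τ β₀ M₀ βs x (fun i => ε i ω) j) * ε j ω) ^ 2 ∂P) atTop (𝓝 0) := by
  have hmu : ∀ j, Measurable fun e => predErr τ β₀ M₀ βs x e j ^ 2 := fun j =>
    (measurable_predErr_noise β₀ βs x hτ j).pow_const 2
  have hdep : ∀ j, ∀ e e' : ℕ → ℝ, (∀ i < j, e i = e' i) →
      predErr τ β₀ M₀ βs x e j ^ 2 = predErr τ β₀ M₀ βs x e' j ^ 2 :=
    fun j e e' he => by rw [predErr_congr _ _ _ _ (fun _ _ => rfl) he]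
  have hiu := fun j => integrable_sq_predErr β₀ βs x h hτ hM₀ j
  have hi2 := fun j : ℕ =>
    (h.integrable_mul_sq (hmu j) (hdep j) (hiu j)).const_mul (2 / ((j : ℝ) + 1))
  have hi1 := fun j : ℕ => h.integrable_min_mul_sq τ j ((j : ℝ) + 1) (by positivity)
  have hi3 := fun j => ((hi1 j).add (hi2 j)).const_mul ((τ : ℝ) ^ 5)
  have hle := fun j ω => sq_weight_sub_mul_le β₀ M₀ βs x (fun i => ε i ω) hτ j
  have hint : ∀ j, Integrable (fun ω => ((weight τ β₀ M₀ βs x (fun i => ε i ω) j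
        - predWeight τ β₀ M₀ βs x (fun i => ε i ω) j) * ε j ω) ^ 2) P := fun j => by
    have hm1 := measurable_weight β₀ M₀ βs hτ (ξ := fun _ : Ω => x) (η := fun ω i => ε i ω)
      (fun _ => measurable_const) h.measurable j
    have hm2 := (measurable_predWeight β₀ M₀ βs x hτ j).comp (measurable_pi_iff.2 h.measurable)
    refine (hi3 j).mono' (((hm1.sub hm2).mul (h.measurable j)).pow_const 2).aestronglyMeasurable
      (Eventually.of_forall fun ω => ?_)
    rw [Real.norm_of_nonneg (sq_nonneg _)]
    exact hle j ω
  refine ⟨hint, ?_⟩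
  have hlim := ((h.tendsto_integral_min_mul_sq τ).add (hu.mul_const (2 * σ ^ 2))).const_mul
    ((τ : ℝ) ^ 5)
  rw [zero_mul, add_zero, mul_zero] at hlim
  refine squeeze_zero (fun j => integral_nonneg fun ω => sq_nonneg _) (fun j => ?_) hlim
  refine (integral_mono (hint j) (hi3 j) (hle j)).trans (le_of_eq ?_)
  simp only [Pi.add_apply]
  rw [integral_const_mul, integral_add (hi1 j) (hi2 j), integral_const_mul,
    h.integral_mul_sq (hmu j) (hdep j)]
  ring

/-- Along a design with convergent second moments the recursive estimate is consistent in mean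
square. -/
theorem tendsto_integral_sq_norm_err (h : IsNoise P ε σ) (hτ : 1 ≤ τ) (hM₀ : M₀.PosDef) {m c : ℝ}
    (hm : Tendsto (fun k : ℕ => (∑ i ∈ Finset.range k, ‖x i‖ ^ 2) / k) atTop (𝓝 m)) (hc : 0 < c)
    (hv : ∀ᶠ k : ℕ in atTop, ∀ v, c * k * ‖v‖ ^ 2 ≤ ∑ i ∈ Finset.range k, ⟪x i, v⟫ ^ 2) :
    Tendsto (fun k => ∫ ω, ‖err τ β₀ M₀ βs x (fun i => ε i ω) k‖ ^ 2 ∂P) atTop (𝓝 0) := by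
  obtain ⟨B, hB⟩ := exists_sum_le_mul_of_tendsto hm
  obtain ⟨C, hC⟩ := exists_eventually_integral_sq_norm_err_le β₀ βs h hτ hM₀ hB hc hv
  have hτ' : (0 : ℝ) < τ := by exact_mod_cast hτ
  -- Boundedness from the first pass suffices here, since `‖x j‖² / (j + 1)` tends to zero.
  have hu : Tendsto (fun j : ℕ => (∫ ω, predErr τ β₀ M₀ βs x (fun i => ε i ω) j ^ 2 ∂P)
      / ((j : ℝ) + 1)) atTop (𝓝 0) := by
    have h1 := (tendsto_div_succ_of_tendsto_average hm).mul_const C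
    rw [zero_mul] at h1
    refine squeeze_zero' (Eventually.of_forall fun j =>
      div_nonneg (integral_nonneg fun ω => sq_nonneg _) (by positivity)) ?_ h1
    filter_upwards [hC] with j hj
    rw [div_mul_eq_mul_div]
    gcongr
    exact (integral_sq_predErr_le β₀ βs x h hτ hM₀ j).trans (by gcongr)
  obtain ⟨hqi, hq⟩ := tendsto_integral_sq_weight_sub_mul β₀ βs h hτ hM₀ hu
  set q : ℕ → ℝ := fun j => ∫ ω, ((weight τ β₀ M₀ βs x (fun i => ε i ω) j
        - predWeight τ β₀ M₀ βs x (fun i => ε i ω) j) * ε j ω) ^ 2 ∂P with hqdef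
  set p := ‖precOp M₀ (β₀ - βs)‖ with hp
  have hinv : Tendsto (fun k : ℕ => (k : ℝ)⁻¹) atTop (𝓝 0) := tendsto_inv_atTop_nhds_zero_nat
  -- After division by `k²`, the initial value contributes order `k⁻²`, the martingale order `k⁻¹`,
  -- and the weight correction a Cesàro mean of `q`.
  have hlim : Tendsto (fun k : ℕ => (((τ : ℝ)⁻¹ * c) ^ 2)⁻¹ * (3 * p ^ 2 * ((k : ℝ)⁻¹ * (k : ℝ)⁻¹)
      + 3 * (τ ^ 2 * σ ^ 2 * B) * (k : ℝ)⁻¹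
      + 3 * B * ((k : ℝ)⁻¹ * ∑ i ∈ Finset.range k, q i))) atTop (𝓝 0) := by
    have := ((((hinv.mul hinv).const_mul (3 * p ^ 2)).add
      (hinv.const_mul (3 * (τ ^ 2 * σ ^ 2 * B)))).add (hq.cesaro.const_mul (3 * B))).const_mul
        (((τ : ℝ)⁻¹ * c) ^ 2)⁻¹
    simpa using this
  refine squeeze_zero' (Eventually.of_forall fun k => integral_nonneg fun ω => sq_nonneg _) ?_ hlim
  filter_upwards [hv, eventually_ge_atTop 1] with k hk hk1
  have hk1' : (0 : ℝ) < k := by exact_mod_cast hk1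
  have hN := integral_sq_norm_martScore_le β₀ (M₀ := M₀) βs x h hτ k
  have hsum := integrable_finsetSum (Finset.range k) fun i _ => hqi i
  have hi12 : Integrable (fun ω => 3 * p ^ 2
      + 3 * ‖martScore τ β₀ M₀ βs x (fun i => ε i ω) k‖ ^ 2) P :=
    (integrable_const _).add (hN.1.const_mul 3)
  have hi3 := hsum.const_mul (3 * ∑ i ∈ Finset.range k, ‖x i‖ ^ 2)
  have hbd := mul_integral_sq_norm_err_le β₀ βs h hτ hM₀ (c := c * k) (by positivity) hk
    (hi12.add hi3) fun ω => sq_norm_score_le_martScore β₀ M₀ βs x (fun i => ε i ω) k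
  simp only [Pi.add_apply] at hbd
  rw [integral_add hi12 hi3, integral_add (integrable_const _) (hN.1.const_mul 3),
    integral_const_mul, integral_const_mul, integral_const_mul,
    integral_finsetSum _ fun i _ => hqi i] at hbd
  simp only [integral_const, probReal_univ, one_smul] at hbd
  set a := ∫ ω, ‖err τ β₀ M₀ βs x (fun i => ε i ω) k‖ ^ 2 ∂P
  have hq0 : 0 ≤ ∑ i ∈ Finset.range k, q i :=
    Finset.sum_nonneg fun i _ => integral_nonneg fun ω => sq_nonneg _
  have h1 : ((τ : ℝ)⁻¹ * c) ^ 2 * a * k ^ 2 ≤ 3 * p ^ 2 + 3 * (τ ^ 2 * σ ^ 2 * (B * k))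
      + 3 * (B * k) * ∑ i ∈ Finset.range k, q i := by
    calc _ = ((τ : ℝ)⁻¹ * (c * k)) ^ 2 * a := by ring
      _ ≤ _ := hbd
      _ ≤ _ := by
        refine add_le_add (add_le_add le_rfl ?_) ?_
        · have := hN.2.trans (mul_le_mul_of_nonneg_left (hB k) (by positivity))
          exact mul_le_mul_of_nonneg_left this (by norm_num)
        · exact mul_le_mul_of_nonneg_right
            (mul_le_mul_of_nonneg_left (hB k) (by norm_num)) hq0
  rw [le_inv_mul_iff₀ (by positivity)]
  rw [← le_div_iff₀ (by positivity)] at h1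
  refine h1.trans (le_of_eq ?_)
  field_simp

/-- The `‖x i‖²` may be unbounded, so single prediction errors need not vanish; their averages do,
by a weighted Cesàro argument. -/
theorem tendsto_average_integral_sq_predErr (h : IsNoise P ε σ) (hτ : 1 ≤ τ) (hM₀ : M₀.PosDef)
    {m c : ℝ}
    (hm : Tendsto (fun k : ℕ => (∑ i ∈ Finset.range k, ‖x i‖ ^ 2) / k) atTop (𝓝 m)) (hc : 0 < c)
    (hv : ∀ᶠ k : ℕ in atTop, ∀ v, c * k * ‖v‖ ^ 2 ≤ ∑ i ∈ Finset.range k, ⟪x i, v⟫ ^ 2) :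
    Tendsto (fun k : ℕ => (∑ i ∈ Finset.range k,
      ∫ ω, predErr τ β₀ M₀ βs x (fun j => ε j ω) i ^ 2 ∂P) / k) atTop (𝓝 0) := by
  obtain ⟨B, hB⟩ := exists_sum_le_mul_of_tendsto hm
  refine squeeze_zero (fun k => div_nonneg (Finset.sum_nonneg fun i _ =>
    integral_nonneg fun ω => sq_nonneg _) (Nat.cast_nonneg k)) (fun k => ?_)
    (tendsto_sum_mul_div_of_tendsto_zero (fun i => sq_nonneg ‖x i‖) hB
      (tendsto_integral_sq_norm_err β₀ βs h hτ hM₀ hm hc hv))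
  gcongr with i hi
  exact integral_sq_predErr_le β₀ βs x h hτ hM₀ i

theorem tendsto_integral_xiSq (h : IsNoise P ε σ) (hτ : 1 ≤ τ) (hM₀ : M₀.PosDef)
    {m c : ℝ}
    (hm : Tendsto (fun k : ℕ => (∑ i ∈ Finset.range k, ‖x i‖ ^ 2) / k) atTop (𝓝 m)) (hc : 0 < c)
    (hv : ∀ᶠ k : ℕ in atTop, ∀ v, c * k * ‖v‖ ^ 2 ≤ ∑ i ∈ Finset.range k, ⟪x i, v⟫ ^ 2) :
    Tendsto (fun k => ∫ ω, (traj τ β₀ M₀ βs x (fun i => ε i ω) k).xiSq ∂P) atTop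
      (𝓝 (σ ^ 2)) := by
  have h1 := (tendsto_average_integral_sq_predErr β₀ βs h hτ hM₀ hm hc hv).const_add (σ ^ 2)
  rw [add_zero] at h1
  refine h1.congr' ?_
  filter_upwards [eventually_ge_atTop 1] with k hk
  have hk' : (k : ℝ) ≠ 0 := by exact_mod_cast (show k ≠ 0 by omega)
  rw [(integral_xiSq β₀ βs x h hτ hM₀ k).2, Finset.sum_add_distrib, Finset.sum_const,
    Finset.card_range, nsmul_eq_mul]
  field_simp

theorem IsNoise.tendsto_integral_phi_average (h : IsNoise P ε σ) (hτ : 1 ≤ τ) :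
    Tendsto (fun k : ℕ => ∫ ω, phi τ ((∑ i ∈ Finset.range k, ε i ω ^ 2) / k) ∂P) atTop
      (𝓝 (phi τ (σ ^ 2))) := by
  have hlaw := strong_law_ae_real (μ := P) (fun i ω => ε i ω ^ 2) (h.integrable_sq 0)
    (fun i j hij => (h.indep.indepFun hij).comp (measurable_id.pow_const 2)
      (measurable_id.pow_const 2))
    (fun i => (h.identDistrib i).comp (measurable_id.pow_const 2))
  rw [h.integral_sq 0] at hlaw
  rw [show phi τ (σ ^ 2) = ∫ _, phi τ (σ ^ 2) ∂P by simp]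
  refine tendsto_integral_of_dominated_convergence (fun _ => (τ : ℝ)) (fun k => ?_)
    (integrable_const _) (fun k => Eventually.of_forall fun ω => ?_) ?_
  · exact ((continuous_phi hτ).measurable.comp ((Finset.measurable_sum _ fun i _ =>
      (h.measurable i).pow_const 2).div_const _)).aestronglyMeasurable
  · rw [Real.norm_of_nonneg (phi_pos hτ _).le]
    exact phi_le hτ _
  · filter_upwards [hlaw] with ω hω
    exact ((continuous_phi hτ).tendsto _).comp hω

theorem sq_integral_abs_le {Z : Ω → ℝ} (hZ : AEStronglyMeasurable Z P)
    (hi : Integrable (fun ω => Z ω ^ 2) P) : (∫ ω, |Z ω| ∂P) ^ 2 ≤ ∫ ω, Z ω ^ 2 ∂P := by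
  have h2 : MemLp (fun ω => |Z ω|) 2 P := ((memLp_two_iff_integrable_sq hZ).2 hi).abs
  -- Jensen's inequality, as nonnegativity of the variance of `|Z|`.
  have := variance_nonneg (fun ω => |Z ω|) P
  rw [variance_eq_sub h2] at this
  simpa using this

/-- Cauchy–Schwarz twice, over the sample space and over the indices; independence gives the second
moment `σ² E u_i²` of the product, with `u_i` the prediction error. -/
theorem tendsto_average_integral_abs_predErr_mul (h : IsNoise P ε σ) (hτ : 1 ≤ τ)
    (hM₀ : M₀.PosDef)
    (hu : Tendsto (fun k : ℕ => (∑ i ∈ Finset.range k,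
      ∫ ω, predErr τ β₀ M₀ βs x (fun j => ε j ω) i ^ 2 ∂P) / k) atTop (𝓝 0)) :
    Tendsto (fun k : ℕ => (∑ i ∈ Finset.range k,
      ∫ ω, |predErr τ β₀ M₀ βs x (fun j => ε j ω) i * ε i ω| ∂P) / k) atTop (𝓝 0) := by
  have hmu := fun j => (measurable_predErr_noise β₀ (M₀ := M₀) βs x hτ j)
  have hdep : ∀ j, ∀ e e' : ℕ → ℝ, (∀ i < j, e i = e' i) →
      predErr τ β₀ M₀ βs x e j ^ 2 = predErr τ β₀ M₀ βs x e' j ^ 2 :=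
    fun j e e' he => by rw [predErr_congr _ _ _ _ (fun _ _ => rfl) he]
  have hsq : ∀ i, (∫ ω, |predErr τ β₀ M₀ βs x (fun j => ε j ω) i * ε i ω| ∂P) ^ 2
      ≤ (∫ ω, predErr τ β₀ M₀ βs x (fun j => ε j ω) i ^ 2 ∂P) * σ ^ 2 := fun i => by
    rw [← h.integral_mul_sq ((hmu i).pow_const 2) (hdep i)]
    simp only [← mul_pow]
    refine sq_integral_abs_le (((hmu i).comp (measurable_pi_iff.2 h.measurable)).mul
      (h.measurable i)).aestronglyMeasurable ?_
    simp only [mul_pow]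
    exact h.integrable_mul_sq ((hmu i).pow_const 2) (hdep i)
      (integrable_sq_predErr β₀ βs x h hτ hM₀ i)
  have hlim := (hu.mul_const (σ ^ 2)).sqrt
  rw [zero_mul, Real.sqrt_zero] at hlim
  refine squeeze_zero (fun k => div_nonneg (Finset.sum_nonneg fun i _ =>
    integral_nonneg fun ω => abs_nonneg _) (Nat.cast_nonneg k)) (fun k => ?_) hlim
  refine Real.le_sqrt_of_sq_le ?_
  have hcs := sq_sum_le_card_mul_sum_sq (s := Finset.range k)
    (f := fun i => ∫ ω, |predErr τ β₀ M₀ βs x (fun j => ε j ω) i * ε i ω| ∂P)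
  rw [Finset.card_range] at hcs
  have hcs' := hcs.trans (mul_le_mul_of_nonneg_left (Finset.sum_le_sum fun i _ => hsq i)
    (Nat.cast_nonneg k))
  rw [← Finset.sum_mul] at hcs'
  rcases Nat.eq_zero_or_pos k with rfl | hk
  · simp
  have hk' : (0 : ℝ) < k := by exact_mod_cast hk
  rw [div_pow, div_le_iff₀ (by positivity)]
  refine hcs'.trans (le_of_eq ?_)
  field_simp

/-- Replacing residuals by noise in `ξ_k²` costs, in `L¹`, at most the averages of `2|u_i ε_i|` and
`u_i²`, with `u_i` the prediction errors; then the strong law for `ε_i²` applies. -/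
theorem tendsto_integral_phi_xiSq (h : IsNoise P ε σ) (hτ : 1 ≤ τ) (hM₀ : M₀.PosDef)
    {m c : ℝ}
    (hm : Tendsto (fun k : ℕ => (∑ i ∈ Finset.range k, ‖x i‖ ^ 2) / k) atTop (𝓝 m)) (hc : 0 < c)
    (hv : ∀ᶠ k : ℕ in atTop, ∀ v, c * k * ‖v‖ ^ 2 ≤ ∑ i ∈ Finset.range k, ⟪x i, v⟫ ^ 2) :
    Tendsto (fun k => ∫ ω, phi τ (traj τ β₀ M₀ βs x (fun i => ε i ω) k).xiSq ∂P) atTop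
      (𝓝 (phi τ (σ ^ 2))) := by
  have hu := tendsto_average_integral_sq_predErr β₀ βs h hτ hM₀ hm hc hv
  have hcross := tendsto_average_integral_abs_predErr_mul β₀ βs h hτ hM₀ hu
  have hlim := (hcross.const_mul 2).add hu
  rw [mul_zero, add_zero] at hlim
  have hphi : ∀ {Z : Ω → ℝ}, Measurable Z → Integrable (fun ω => phi τ (Z ω)) P := fun hZ =>
    (integrable_const (τ : ℝ)).mono' ((continuous_phi hτ).measurable.comp hZ).aestronglyMeasurable
      (Eventually.of_forall fun ω => by
        rw [Real.norm_of_nonneg (phi_pos hτ _).le]; exact phi_le hτ _)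
  have hmξ := fun k => measurable_xiSq_traj β₀ M₀ βs hτ (ξ := fun _ : Ω => x)
    (η := fun ω i => ε i ω) (fun _ => measurable_const) h.measurable k
  have hmS : ∀ k : ℕ, Measurable fun ω => (∑ i ∈ Finset.range k, ε i ω ^ 2) / (k : ℝ) := fun k =>
    (Finset.measurable_sum _ fun i _ => (h.measurable i).pow_const 2).div_const _
  refine tendsto_of_tendsto_of_dist (h.tendsto_integral_phi_average hτ)
    (squeeze_zero (fun _ => dist_nonneg) (fun k => ?_) hlim)
  have hic : ∀ i, Integrable (fun ω => |predErr τ β₀ M₀ βs x (fun j => ε j ω) i * ε i ω|) P :=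
    fun i => (h.integrable_mul (measurable_predErr_noise β₀ βs x hτ i)
      (fun e e' he => predErr_congr _ _ _ _ (fun _ _ => rfl) he)
      (integrable_predErr β₀ βs x h hτ hM₀ i)).abs
  have hiu := fun i => integrable_sq_predErr β₀ βs x h hτ hM₀ i
  have hib1 := ((integrable_finsetSum (Finset.range k) fun i _ => hic i).div_const
    (k : ℝ)).const_mul 2
  have hib2 := (integrable_finsetSum (Finset.range k) fun i _ => hiu i).div_const (k : ℝ)
  rw [dist_comm, Real.dist_eq, ← integral_sub (hphi (hmξ k)) (hphi (hmS k))]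
  refine (abs_integral_le_integral_abs).trans ?_
  refine (integral_mono ((hphi (hmξ k)).sub (hphi (hmS k))).abs (hib1.add hib2)
    fun ω => ?_).trans (le_of_eq ?_)
  · refine (abs_phi_sub_phi_le hτ _ _).trans ?_
    simp only [Pi.add_apply]
    rw [traj_xiSq, ← sub_div, ← Finset.sum_sub_distrib, abs_div, Nat.abs_cast, ← mul_div_assoc,
      ← add_div, Finset.mul_sum, ← Finset.sum_add_distrib]
    gcongr
    refine (Finset.abs_sum_le_sum_abs _ _).trans (Finset.sum_le_sum fun i _ => ?_)
    set u := predErr τ β₀ M₀ βs x (fun j => ε j ω) i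
    rw [show (ε i ω - u) ^ 2 - ε i ω ^ 2 = -(2 * (u * ε i ω)) + u ^ 2 by ring]
    refine (abs_add_le _ _).trans (le_of_eq ?_)
    rw [abs_neg, abs_mul, abs_two, abs_of_nonneg (sq_nonneg u)]
  · simp only [Pi.add_apply]
    rw [integral_add hib1 hib2, integral_const_mul, integral_div, integral_div,
      integral_finsetSum _ fun i _ => hic i, integral_finsetSum _ fun i _ => hiu i]

end Noise

/-! ### Conditioning on the design and the random covariates -/

/-- Conditioning on one of two independent variables is freezing it. -/
theorem condExp_comap_ae_eq_integral_of_indepFun {Ω α β : Type*} [mΩ : MeasurableSpace Ω]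
    {P : Measure Ω} [IsProbabilityMeasure P] [mα : MeasurableSpace α] [MeasurableSpace β]
    [StandardBorelSpace β] [Nonempty β] {Z : Ω → α} {W : Ω → β} (hZ : Measurable Z)
    (hW : Measurable W) (h : IndepFun Z W P) {F : α × β → ℝ} (hF : Measurable F)
    (hint : Integrable (fun ω => F (Z ω, W ω)) P) :
    P[fun ω => F (Z ω, W ω) | mα.comap Z] =ᵐ[P] fun ω => ∫ ω', F (Z ω, W ω') ∂P := by
  have : IsProbabilityMeasure (P.map W) := Measure.isProbabilityMeasure_map hW.aemeasurable
  -- Independence makes the joint law a product, so the conditional law is a constant kernel.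
  have h1 : condDistrib W Z P =ᵐ[P.map Z] Kernel.const α (P.map W) := by
    refine condDistrib_ae_eq_of_measure_eq_compProd Z hW.aemeasurable ?_
    rw [Measure.compProd_const]
    exact (indepFun_iff_map_prod_eq_prod_map_map hZ.aemeasurable hW.aemeasurable).1 h
  filter_upwards [condExp_prod_ae_eq_integral_condDistrib₀ (μ := P) hZ hW.aemeasurable
    hF.aestronglyMeasurable hint, ae_of_ae_map hZ.aemeasurable h1] with ω h2 h3
  rw [h2, h3, Kernel.const_apply, integral_map (f := fun y => F (Z ω, y)) hW.aemeasurable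
    (hF.comp (measurable_const.prodMk measurable_id)).aestronglyMeasurable]

theorem sigmaX_eq_comap {Ω : Type*} {n : ℕ} (X : ℕ → Ω → EuclideanSpace ℝ (Fin n)) (k : ℕ) :
    sigmaX X k = MeasurableSpace.comap (fun ω (i : {i : ℕ // i < k}) => X i ω) inferInstance := by
  rw [sigmaX, iSup_subtype']
  change _ = MeasurableSpace.comap _ MeasurableSpace.pi
  simp only [MeasurableSpace.pi, MeasurableSpace.comap_iSup, MeasurableSpace.comap_comp]
  rfl

section Random

variable {Ω : Type*} [MeasurableSpace Ω] {P : Measure Ω} {n : ℕ}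
  {X : ℕ → Ω → EuclideanSpace ℝ (Fin n)} {Y ε : ℕ → Ω → ℝ}
  {βs : EuclideanSpace ℝ (Fin n)} {σ : ℝ}

theorem LinearModel.identDistrib_X (h : LinearModel P X Y ε βs σ) (i : ℕ) :
    IdentDistrib (X i) (X 0) P P :=
  (h.identDistrib_data i).comp measurable_fst

theorem LinearModel.indepFun_X (h : LinearModel P X Y ε βs σ) {i j : ℕ} (hij : i ≠ j) :
    IndepFun (X i) (X j) P :=
  (h.indep_data.indepFun hij).comp measurable_fst measurable_fst

theorem LinearModel.xiSq_ae_eq {τ : ℕ} (β₀ : EuclideanSpace ℝ (Fin n))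
    {M₀ : Matrix (Fin n) (Fin n) ℝ} (h : LinearModel P X Y ε βs σ) (k : ℕ) :
    xiSq τ β₀ M₀ (fun _ => 1) X Y k
      =ᵐ[P] fun ω => (traj τ β₀ M₀ βs (fun i => X i ω) (fun i => ε i ω) k).xiSq := by
  filter_upwards [ae_all_iff.2 h.model] with ω hω
  simp only [xiSq, traj, hω]

theorem LinearModel.memLp_X (h : LinearModel P X Y ε βs σ) (hL2 : MemLp (X 0) 2 P) (i : ℕ) :
    MemLp (X i) 2 P := (h.identDistrib_X i).symm.memLp_snd hL2

theorem LinearModel.integrable_sq_norm_X (h : LinearModel P X Y ε βs σ) (hL2 : MemLp (X 0) 2 P)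
    (i : ℕ) : Integrable (fun ω => ‖X i ω‖ ^ 2) P :=
  (h.memLp_X hL2 i).norm.integrable_sq

theorem LinearModel.tendsto_average_sq_norm_X (h : LinearModel P X Y ε βs σ)
    (hL2 : MemLp (X 0) 2 P) :
    ∀ᵐ ω ∂P, Tendsto (fun k : ℕ => (∑ i ∈ Finset.range k, ‖X i ω‖ ^ 2) / k) atTop
      (𝓝 (∫ ω, ‖X 0 ω‖ ^ 2 ∂P)) :=
  strong_law_ae_real (μ := P) (fun i ω => ‖X i ω‖ ^ 2) (h.integrable_sq_norm_X hL2 0)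
    (fun _ _ hij => (h.indepFun_X hij).comp (measurable_norm.pow_const 2)
      (measurable_norm.pow_const 2))
    (fun i => (h.identDistrib_X i).comp (measurable_norm.pow_const 2))

variable [IsProbabilityMeasure P]

/-- Conditional expectations given the first `k` covariates of functionals of these covariates
and of the noise. -/
theorem LinearModel.condExp_sigmaX (h : LinearModel P X Y ε βs σ) {k : ℕ}
    {F : (ℕ → EuclideanSpace ℝ (Fin n)) → (ℕ → ℝ) → ℝ} (hF : Measurable (Function.uncurry F))
    (hdep : ∀ x x' e, (∀ i < k, x i = x' i) → F x e = F x' e)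
    (hint : Integrable (fun ω => F (fun i => X i ω) fun i => ε i ω) P) :
    P[fun ω => F (fun i => X i ω) (fun i => ε i ω) | sigmaX X k]
      =ᵐ[P] fun ω => ∫ ω', F (fun i => X i ω) (fun i => ε i ω') ∂P := by
  let ext : ({i : ℕ // i < k} → EuclideanSpace ℝ (Fin n)) → ℕ → EuclideanSpace ℝ (Fin n) :=
    fun v i => if hi : i < k then v ⟨i, hi⟩ else 0
  have hext : Measurable ext := by
    refine measurable_pi_iff.2 fun i => ?_
    by_cases hi : i < k
    · simp only [ext, dif_pos hi]; exact measurable_pi_apply _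
    · simp only [ext, dif_neg hi]; exact measurable_const
  let Z : Ω → {i : ℕ // i < k} → EuclideanSpace ℝ (Fin n) := fun ω i => X i ω
  have hZ : Measurable Z := measurable_pi_iff.2 fun i => h.measurable_X i
  have hW : Measurable fun ω i => ε i ω := measurable_pi_iff.2 h.measurable_noise
  have hind : IndepFun Z (fun ω i => ε i ω) P :=
    (h.noise_indep_X.comp measurable_id (ψ := fun v (i : {i : ℕ // i < k}) => v i)
      (measurable_pi_iff.2 fun i => measurable_pi_apply _)).symm
  have heq : ∀ ω e, F (fun i => X i ω) e = F (ext (Z ω)) e := fun ω e =>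
    hdep _ _ _ fun i hi => by simp [ext, Z, hi]
  simp only [heq] at hint ⊢
  rw [sigmaX_eq_comap]
  exact condExp_comap_ae_eq_integral_of_indepFun hZ hW hind
    (F := fun p => F (ext p.1) p.2)
    (hF.comp ((hext.comp measurable_fst).prodMk measurable_snd)) hint

/-- The strong law is applied to the operators `x xᵀ`, so a single null set and a single threshold
serve all directions: the empirical mean is eventually within `c/2` of the limit in operator norm,
and the limit is coercive with constant `c`. -/
theorem LinearModel.exists_eventually_le_sum_sq_inner (h : LinearModel P X Y ε βs σ)
    (hL2 : MemLp (X 0) 2 P)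
    (hspan : ∀ v : EuclideanSpace ℝ (Fin n), ‖v‖ = 1 →
      P {ω | |(X 0 ω).ofLp ⬝ᵥ v.ofLp| = 0} < 1) :
    ∃ c > 0, ∀ᵐ ω ∂P, ∀ᶠ k : ℕ in atTop, ∀ v,
      c * k * ‖v‖ ^ 2 ≤ ∑ i ∈ Finset.range k, ⟪X i ω, v⟫ ^ 2 := by
  let R : EuclideanSpace ℝ (Fin n) → EuclideanSpace ℝ (Fin n) →L[ℝ] EuclideanSpace ℝ (Fin n) :=
    fun y => InnerProductSpace.rankOne ℝ y y
  have hRc : Continuous R := continuous_clm_apply.2 fun v => by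
    simp only [R, InnerProductSpace.rankOne_apply]
    fun_prop
  have hR : ∀ y v, ⟪v, R y v⟫ = ⟪y, v⟫ ^ 2 := fun y v => by
    simp only [R, InnerProductSpace.rankOne_apply, inner_smul_right, real_inner_comm v, sq]
  have hRi : Integrable (fun ω => R (X 0 ω)) P := by
    refine (h.integrable_sq_norm_X hL2 0).mono'
      (hRc.comp_aestronglyMeasurable (h.measurable_X 0).aestronglyMeasurable)
      (Eventually.of_forall fun ω => le_of_eq ?_)
    simp only [R, InnerProductSpace.norm_rankOne, sq]
  set T := ∫ ω, R (X 0 ω) ∂P with hT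
  have hTv : ∀ v, ⟪v, T v⟫ = ∫ ω, ⟪X 0 ω, v⟫ ^ 2 ∂P := fun v => by
    rw [hT, ContinuousLinearMap.integral_apply hRi,
      ← integral_inner (hRi.apply_continuousLinearMap v)]
    simp only [hR]
  obtain ⟨c, hc, hcT⟩ := exists_pos_mul_sq_norm_le_inner T fun v hv => by
    rw [hTv]
    have hi : Integrable (fun ω => ⟪X 0 ω, v⟫ ^ 2) P := (hL2.inner_const v).integrable_sq
    -- If the form vanished at `v`, then `X 0` would be almost surely orthogonal to `v`, against
    -- `hspan`.
    refine lt_of_le_of_ne (integral_nonneg fun ω => sq_nonneg _) fun h0 => ?_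
    have h1 := (integral_eq_zero_iff_of_nonneg (fun ω => sq_nonneg _) hi).1 h0.symm
    refine (hspan v hv).ne
      ((measure_eq_measure_of_null_sdiff (Set.subset_univ _) ?_).trans measure_univ)
    · rw [← Set.compl_eq_univ_sdiff]
      change ∀ᵐ ω ∂P, |(X 0 ω).ofLp ⬝ᵥ v.ofLp| = 0
      filter_upwards [h1] with ω hω
      simpa [dotProduct_eq_inner] using hω
  refine ⟨c / 2, half_pos hc, ?_⟩
  have hlaw := strong_law_ae (μ := P) (fun i ω => R (X i ω)) hRi
    (fun _ _ hij => (h.indepFun_X hij).comp hRc.measurable hRc.measurable)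
    (fun i => (h.identDistrib_X i).comp hRc.measurable)
  filter_upwards [hlaw] with ω hω
  filter_upwards [hω.eventually (Metric.ball_mem_nhds T (half_pos hc)), eventually_ge_atTop 1]
    with k hk hk1 v
  have hk1' : (0 : ℝ) < k := by exact_mod_cast hk1
  set S := (k : ℝ)⁻¹ • ∑ i ∈ Finset.range k, R (X i ω) with hS
  have h1 : ⟪v, S v⟫ = (k : ℝ)⁻¹ * ∑ i ∈ Finset.range k, ⟪X i ω, v⟫ ^ 2 := by
    simp only [hS, smul_apply, sum_apply, inner_smul_right, inner_sum, hR]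
  have h2 : ⟪v, (T - S) v⟫ ≤ c / 2 * ‖v‖ ^ 2 := by
    rw [dist_comm, dist_eq_norm] at hk
    calc _ ≤ ‖v‖ * ‖(T - S) v‖ := real_inner_le_norm _ _
      _ ≤ ‖v‖ * (c / 2 * ‖v‖) := by
        gcongr
        exact (T - S).le_of_opNorm_le hk.le v
      _ = _ := by ring
  rw [sub_apply, inner_sub_right] at h2
  have h3 : c / 2 * ‖v‖ ^ 2 ≤ (k : ℝ)⁻¹ * ∑ i ∈ Finset.range k, ⟪X i ω, v⟫ ^ 2 := by
    rw [← h1]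
    linarith [hcT v]
  rw [le_inv_mul_iff₀ hk1'] at h3
  linarith

variable {τ : ℕ} (β₀ : EuclideanSpace ℝ (Fin n)) {M₀ : Matrix (Fin n) (Fin n) ℝ}

/-- Second moments suffice because the error before step `i + 1` involves only covariates `X j` with
`j < i`, so each product `‖X i‖² ‖X j‖² ε_l²` has independent factors. -/
theorem LinearModel.integrable_xiSq_traj (h : LinearModel P X Y ε βs σ) (hL2 : MemLp (X 0) 2 P)
    (hτ : 1 ≤ τ) (hM₀ : M₀.PosDef) (k : ℕ) :
    Integrable (fun ω => (traj τ β₀ M₀ βs (fun i => X i ω) (fun i => ε i ω) k).xiSq) P := by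
  obtain ⟨c, hc, hle⟩ := exists_pos_mul_norm_err_le β₀ βs hτ hM₀
  have hX := h.integrable_sq_norm_X hL2
  have hε := h.isNoise.integrable_sq
  have hmu := measurable_predErr β₀ M₀ βs hτ (ξ := fun ω i => X i ω) (η := fun ω i => ε i ω)
    h.measurable_X h.measurable_noise
  have hXX : ∀ {i j : ℕ}, i ≠ j → Integrable (fun ω => ‖X i ω‖ ^ 2 * ‖X j ω‖ ^ 2) P :=
    fun hij => ((h.indepFun_X hij).comp (measurable_norm.pow_const 2)
      (measurable_norm.pow_const 2)).integrable_mul (hX _) (hX _)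
  have hXXε : ∀ {i j : ℕ} (l : ℕ), i ≠ j →
      Integrable (fun ω => ‖X i ω‖ ^ 2 * ‖X j ω‖ ^ 2 * ε l ω ^ 2) P := fun {i j} l hij =>
    (h.noise_indep_X.symm.comp
      (φ := fun x : ℕ → EuclideanSpace ℝ (Fin n) => ‖x i‖ ^ 2 * ‖x j‖ ^ 2)
      (ψ := fun e : ℕ → ℝ => e l ^ 2) (by fun_prop) (by fun_prop)).integrable_mul (hXX hij) (hε l)
  have hu : ∀ i, Integrable
      (fun ω => predErr τ β₀ M₀ βs (fun i => X i ω) (fun i => ε i ω) i ^ 2) P := fun i => by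
    refine Integrable.mono' (g := fun ω => (c ^ 2)⁻¹ * (2 * ‖precOp M₀ (β₀ - βs)‖ ^ 2 * ‖X i ω‖ ^ 2
      + 2 * τ ^ 2 * ∑ j ∈ Finset.range i, ∑ l ∈ Finset.range i,
        ‖X i ω‖ ^ 2 * ‖X j ω‖ ^ 2 * ε l ω ^ 2)) ?_ ((hmu i).pow_const 2).aestronglyMeasurable
      (Eventually.of_forall fun ω => ?_)
    · refine (((hX i).const_mul _).add (Integrable.const_mul ?_ _)).const_mul _
      exact integrable_finsetSum _ fun j hj => integrable_finsetSum _ fun l _ =>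
        hXXε l (Finset.mem_range.1 hj).ne'
    · rw [Real.norm_of_nonneg (sq_nonneg _), le_inv_mul_iff₀ (by positivity)]
      set x := fun i => X i ω
      set e := fun i => ε i ω
      calc c ^ 2 * predErr τ β₀ M₀ βs x e i ^ 2
          ≤ c ^ 2 * (‖x i‖ ^ 2 * ‖err τ β₀ M₀ βs x e i‖ ^ 2) := by
            gcongr
            exact sq_predErr_le _ _ _ _ _
        _ = ‖x i‖ ^ 2 * (c * ‖err τ β₀ M₀ βs x e i‖) ^ 2 := by ring
        _ ≤ ‖x i‖ ^ 2 * (2 * ‖precOp M₀ (β₀ - βs)‖ ^ 2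
            + 2 * τ ^ 2 * (∑ j ∈ Finset.range i, ‖x j‖ ^ 2) * ∑ l ∈ Finset.range i, e l ^ 2) := by
            gcongr
            refine le_trans ?_ (sq_norm_score_le β₀ βs x e hτ i)
            gcongr
            exact hle _ _ _
        _ = _ := by
            simp only [mul_assoc, ← Finset.mul_sum, ← Finset.sum_mul]
            ring
  simp only [traj_xiSq]
  refine (integrable_finsetSum _ fun i _ => ?_).div_const _
  refine (((hε i).const_mul 2).add ((hu i).const_mul 2)).mono'
    (((h.measurable_noise i).sub (hmu i)).pow_const 2).aestronglyMeasurable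
    (Eventually.of_forall fun ω => ?_)
  rw [Real.norm_of_nonneg (sq_nonneg _), Pi.add_apply]
  nlinarith [sq_nonneg (ε i ω + predErr τ β₀ M₀ βs (fun i => X i ω) (fun i => ε i ω) i)]

end Random

end KSGD

/-! ### Assembly -/

theorem mainTheorem8 {Ω : Type*} [MeasurableSpace Ω] (P : Measure Ω) [IsProbabilityMeasure P]
    (n : ℕ) (X : ℕ → Ω → EuclideanSpace ℝ (Fin n)) (Y ε : ℕ → Ω → ℝ)
    (βstar : EuclideanSpace ℝ (Fin n)) (σ : ℝ)
    (hmodel : KSGD.LinearModel P X Y ε βstar σ)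
    (hL2 : MemLp (X 0) 2 P)
    (hspan : ∀ v : EuclideanSpace ℝ (Fin n), ‖v‖ = 1 →
      P {ω | |(X 0 ω).ofLp ⬝ᵥ v.ofLp| = 0} < 1)
    (β₀ : EuclideanSpace ℝ (Fin n)) (M₀ : Matrix (Fin n) (Fin n) ℝ) (hM₀ : M₀.PosDef)
    (τ : ℕ) (hτ : 1 ≤ τ) (f : ℕ → ℝ) (hf : ∀ k, f k = 1) :
    ((∀ k, Integrable (KSGD.xiSq τ β₀ M₀ f X Y k) P) ∧
      ∀ᵐ ω ∂P, Tendsto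
        (fun k : ℕ => (P[KSGD.xiSq τ β₀ M₀ f X Y k | KSGD.sigmaX X k]) ω) atTop (𝓝 (σ ^ 2))) ∧
    ((∀ k, Integrable (KSGD.gammaSq τ β₀ M₀ f X Y k) P) ∧
      ∀ᵐ ω ∂P,
        ((KSGD.phi τ (σ ^ 2) : ℝ) : EReal) ≤
          liminf (fun k : ℕ =>
            (((P[KSGD.gammaSq τ β₀ M₀ f X Y k | KSGD.sigmaX X k]) ω : ℝ) : EReal)) atTop ∧
        liminf (fun k : ℕ =>
            (((P[KSGD.gammaSq τ β₀ M₀ f X Y k | KSGD.sigmaX X k]) ω : ℝ) : EReal)) atTop ≤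
          limsup (fun k : ℕ =>
            (((P[KSGD.gammaSq τ β₀ M₀ f X Y k | KSGD.sigmaX X k]) ω : ℝ) : EReal)) atTop ∧
        limsup (fun k : ℕ =>
            (((P[KSGD.gammaSq τ β₀ M₀ f X Y k | KSGD.sigmaX X k]) ω : ℝ) : EReal)) atTop ≤
          ((KSGD.phi τ (σ ^ 2 + (τ : ℝ)⁻¹) : ℝ) : EReal)) := by
  obtain rfl : f = fun _ => 1 := funext hf
  have hξ := fun k => hmodel.integrable_xiSq_traj β₀ hL2 hτ hM₀ k
  have hae := fun k => hmodel.xiSq_ae_eq (τ := τ) β₀ (M₀ := M₀) k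
  have hγ : ∀ k, Integrable (fun ω => KSGD.phi τ
      (KSGD.traj τ β₀ M₀ βstar (fun i => X i ω) (fun i => ε i ω) k).xiSq) P := fun k =>
    (integrable_const (τ : ℝ)).mono'
      ((KSGD.continuous_phi hτ).comp_aestronglyMeasurable (hξ k).aestronglyMeasurable)
      (Eventually.of_forall fun ω => by
        rw [Real.norm_of_nonneg (KSGD.phi_pos hτ _).le]; exact KSGD.phi_le hτ _)
  have haeγ : ∀ k, KSGD.gammaSq τ β₀ M₀ (fun _ => 1) X Y k =ᵐ[P] fun ω => KSGD.phi τ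
      (KSGD.traj τ β₀ M₀ βstar (fun i => X i ω) (fun i => ε i ω) k).xiSq := fun k => by
    filter_upwards [hae k] with ω hω
    rw [KSGD.gammaSq, hω]
  have hmF : ∀ k, Measurable fun p : (ℕ → EuclideanSpace ℝ (Fin n)) × (ℕ → ℝ) =>
      (KSGD.traj τ β₀ M₀ βstar p.1 p.2 k).xiSq := fun k =>
    KSGD.measurable_xiSq_traj β₀ M₀ βstar hτ (fun i => (measurable_pi_apply i).comp measurable_fst)
      (fun i => (measurable_pi_apply i).comp measurable_snd) k
  have hcξ := fun k => (condExp_congr_ae (m := KSGD.sigmaX X k) (hae k)).trans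
    (hmodel.condExp_sigmaX
      (F := fun x e => (KSGD.traj τ β₀ M₀ βstar x e k).xiSq) (hmF k)
      (fun x x' e hx => by
        rw [KSGD.traj_congr τ β₀ M₀ βstar hx (fun _ _ => rfl)]) (hξ k))
  have hcγ := fun k => (condExp_congr_ae (m := KSGD.sigmaX X k) (haeγ k)).trans
    (hmodel.condExp_sigmaX
      (F := fun x e => KSGD.phi τ (KSGD.traj τ β₀ M₀ βstar x e k).xiSq)
      ((KSGD.continuous_phi hτ).measurable.comp (hmF k))
      (fun x x' e hx => by
        rw [KSGD.traj_congr τ β₀ M₀ βstar hx (fun _ _ => rfl)]) (hγ k))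
  obtain ⟨c, hc, hv⟩ := hmodel.exists_eventually_le_sum_sq_inner hL2 hspan
  have hm := hmodel.tendsto_average_sq_norm_X hL2
  refine ⟨⟨fun k => (hξ k).congr (hae k).symm, ?_⟩, fun k => (hγ k).congr (haeγ k).symm, ?_⟩
  · filter_upwards [hm, hv, ae_all_iff.2 hcξ] with ω h1 h2 h3
    simp only [h3]
    exact KSGD.tendsto_integral_xiSq β₀ βstar hmodel.isNoise hτ hM₀ h1 hc h2
  · filter_upwards [hm, hv, ae_all_iff.2 hcγ] with ω h1 h2 h3
    -- The limit exists and equals `φ_τ(σ²)`, so the lower and upper limits agree and only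
    -- monotonicity of `φ_τ` remains.
    have hlim := (continuous_coe_real_ereal.tendsto _).comp
      (KSGD.tendsto_integral_phi_xiSq β₀ βstar hmodel.isNoise hτ hM₀ h1 hc h2)
    simp only [Function.comp_def] at hlim
    simp only [h3, hlim.liminf_eq, hlim.limsup_eq, le_refl, true_and]
    exact EReal.coe_le_coe_iff.2 (KSGD.phi_mono hτ (le_add_of_nonneg_right (by positivity)))
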